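/- Let $n\ge 1$. For a partition $\lambda\vdash n$ let $\ell(\lambda)$ be its number of parts, $p_\lambda$ and $m_\lambda$ the power sum and monomial symmetric functions, and $C_\lambda$ the formal sum, in the group algebra $\mathbb{C}S_n$, of all permutations of cycle type $\lambda$ (fixed points counted as parts equal to $1$). The $C_\lambda$, $\lambda\vdash n$, form a basis of the class algebra; let $c^{\nu}_{\lambda\mu}=[C_\nu]\,C_\lambda C_\mu$ be the coefficient of $C_\nu$ in the product $C_\lambda C_\mu$, and write $c^n_{\lambda\mu}=c^{(n)}_{\lambda\mu}$. Then, as identities of symmetric functions (that is, for arbitrary finite sets of variables $x$ and $y$), $$\frac1n\sum_{\lambda,\mu\vdash n}c^n_{\lambda\mu}\,p_\lambda(x)p_\mu(y)=\sum_{\lambda,\mu\vdash n}\frac{(n-\ell(\lambda))!\,(n-\ell(\mu))!}{(n+1-\ell(\lambda)-\ell(\mu))!}\,m_\lambda(x)m_\mu(y),$$ where a term with $\ell(\lambda)+\ell(\mu)>n+1$ is read as $0$, and $$\frac1{n!}\sum_{\lambda\vdash n}c^n_{\lambda,(n)}\,p_\lambda(x)=\sum_{\lambda\vdash n}\frac{m_\lambda(x)}{n+1-\ell(\lambda)}.$$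 -/

import Mathlib

open scoped Nat

/-- The cycle type of a permutation of `{0, …, n-1}`, fixed points included, as a partition
of `n`. -/
def permType {n : ℕ} (g : Equiv.Perm (Fin n)) : n.Partition where
  parts := g.partition.parts
  parts_pos := fun h => g.partition.parts_pos h
  parts_sum := by rw [g.partition.parts_sum, Fintype.card_fin]

/-- The conjugacy class `C_lam` of `S_n`: all permutations of cycle type `lam`. -/
def conjClass {n : ℕ} (lam : n.Partition) : Finset (Equiv.Perm (Fin n)) :=
  Finset.univ.filter fun g => permType g = lam

/-- The formal sum of the elements of `C_lam` in the group algebra `ℂ S_n`. -/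
noncomputable def classSum {n : ℕ} (lam : n.Partition) :
    MonoidAlgebra ℂ (Equiv.Perm (Fin n)) :=
  ∑ g ∈ conjClass lam, MonoidAlgebra.of ℂ (Equiv.Perm (Fin n)) g

theorem mem_conjClass {n : ℕ} {lam : n.Partition} {g : Equiv.Perm (Fin n)} :
    g ∈ conjClass lam ↔ permType g = lam := by
  simp [conjClass]

theorem permType_eq_iff {n : ℕ} {g h : Equiv.Perm (Fin n)} :
    permType g = permType h ↔ IsConj g h := by
  rw [Equiv.Perm.partition_eq_of_isConj, Nat.Partition.ext_iff, Nat.Partition.ext_iff]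
  rfl

theorem permType_conj {n : ℕ} (h g : Equiv.Perm (Fin n)) :
    permType (h * g * h⁻¹) = permType g :=
  permType_eq_iff.2 (isConj_iff.2 ⟨h, rfl⟩).symm

theorem conjClass_nonempty {n : ℕ} (lam : n.Partition) : (conjClass lam).Nonempty := by
  have hle : (lam.parts.filter fun i => 2 ≤ i).sum + (lam.parts.filter fun i => ¬ 2 ≤ i).sum
      = n := by
    rw [← Multiset.sum_add, Multiset.filter_add_not, lam.parts_sum]
  obtain ⟨g, hg⟩ := (Equiv.Perm.exists_with_cycleType_iff (α := Fin n)
    (m := lam.parts.filter fun i => 2 ≤ i)).2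
    ⟨by rw [Fintype.card_fin]; omega, fun a ha => (Multiset.mem_filter.1 ha).2⟩
  have hones : (lam.parts.filter fun i => ¬ 2 ≤ i)
      = Multiset.replicate (n - (lam.parts.filter fun i => 2 ≤ i).sum) 1 := by
    have h1 : ∀ b ∈ lam.parts.filter (fun i => ¬ 2 ≤ i), b = 1 := by
      intro b hb
      have h2 := Multiset.mem_filter.1 hb
      have h3 := lam.parts_pos h2.1
      omega
    have h4 := Multiset.eq_replicate_card.2 h1
    rw [h4, Multiset.sum_replicate, smul_eq_mul, mul_one] at hle
    conv_lhs => rw [h4]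
    congr 1
    omega
  refine ⟨g, mem_conjClass.2 ?_⟩
  rw [Nat.Partition.ext_iff]
  change g.partition.parts = lam.parts
  rw [Equiv.Perm.parts_partition, hg, ← Equiv.Perm.sum_cycleType, hg, Fintype.card_fin, ← hones,
    Multiset.filter_add_not]

theorem classSum_coeff {n : ℕ} (lam : n.Partition) (g : Equiv.Perm (Fin n)) :
    (classSum lam).coeff g = if permType g = lam then 1 else 0 := by
  classical
  simp [classSum, MonoidAlgebra.coeff_sum, Finsupp.single_apply, mem_conjClass]

theorem classSum_mul_coeff {n : ℕ} (lam mu : n.Partition) (g : Equiv.Perm (Fin n)) :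
    (classSum lam * classSum mu).coeff g =
      (((conjClass lam ×ˢ conjClass mu).filter fun q => q.1 * q.2 = g).card : ℂ) := by
  classical
  rw [classSum, classSum, Finset.sum_mul_sum, ← Finset.sum_product']
  simp [MonoidAlgebra.coeff_sum, Finsupp.single_apply, MonoidAlgebra.single_mul_single]

theorem card_factorizations_congr {n : ℕ} (lam mu : n.Partition) {g g' : Equiv.Perm (Fin n)}
    (h : permType g = permType g') :
    ((conjClass lam ×ˢ conjClass mu).filter fun q => q.1 * q.2 = g).card =
      ((conjClass lam ×ˢ conjClass mu).filter fun q => q.1 * q.2 = g').card := by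
  obtain ⟨k, rfl⟩ := isConj_iff.1 (permType_eq_iff.1 h)
  refine Finset.card_bij' (fun q _ => (k * q.1 * k⁻¹, k * q.2 * k⁻¹))
    (fun q _ => (k⁻¹ * q.1 * k, k⁻¹ * q.2 * k)) ?_ ?_ ?_ ?_
  · rintro ⟨a, b⟩ hq
    simp only [Finset.mem_filter, Finset.mem_product, mem_conjClass, permType_conj] at hq ⊢
    refine ⟨hq.1, ?_⟩
    rw [← hq.2]
    group
  · rintro ⟨a, b⟩ hq
    have hc : ∀ x : Equiv.Perm (Fin n), permType (k⁻¹ * x * k) = permType x := fun x => by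
      simpa using permType_conj k⁻¹ x
    simp only [Finset.mem_filter, Finset.mem_product, mem_conjClass, hc] at hq ⊢
    refine ⟨hq.1, ?_⟩
    have h2 : k⁻¹ * a * k * (k⁻¹ * b * k) = k⁻¹ * (a * b) * k := by group
    rw [h2, hq.2]
    group
  · rintro ⟨a, b⟩ -
    ext1 <;> dsimp only <;> group
  · rintro ⟨a, b⟩ -
    ext1 <;> dsimp only <;> group

theorem sum_smul_classSum_coeff {n : ℕ} (c : n.Partition → ℂ) (g : Equiv.Perm (Fin n)) :
    (∑ nu, c nu • classSum nu).coeff g = c (permType g) := by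
  simp [MonoidAlgebra.coeff_sum, classSum_coeff]

/-- The class sums are linearly independent. -/
theorem classSum_linearIndependent (n : ℕ) :
    LinearIndependent ℂ (classSum : n.Partition → MonoidAlgebra ℂ (Equiv.Perm (Fin n))) := by
  rw [Fintype.linearIndependent_iff]
  intro c hc nu
  obtain ⟨g, hg⟩ := conjClass_nonempty nu
  rw [← mem_conjClass.1 hg, ← sum_smul_classSum_coeff c g, hc]
  simp

/-- The span of the class sums, the class algebra, is closed under multiplication. -/
theorem classSum_mul_mem_span {n : ℕ} (lam mu : n.Partition) :
    classSum lam * classSum mu ∈ Submodule.span ℂ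
      (Set.range (classSum : n.Partition → MonoidAlgebra ℂ (Equiv.Perm (Fin n)))) := by
  choose r hr using fun nu : n.Partition => conjClass_nonempty nu
  have h : classSum lam * classSum mu =
      ∑ nu, (classSum lam * classSum mu).coeff (r nu) • classSum nu := by
    ext g
    rw [sum_smul_classSum_coeff, classSum_mul_coeff, classSum_mul_coeff]
    exact_mod_cast card_factorizations_congr lam mu (mem_conjClass.1 (hr _)).symm
  rw [h]
  exact Submodule.sum_mem _ fun nu _ =>
    Submodule.smul_mem _ _ (Submodule.subset_span ⟨nu, rfl⟩)

/-- The connection coefficient `c^nu_{lam mu} = [C_nu] C_lam C_mu`: the coordinate along `C_nu`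
of the product `C_lam C_mu` in the basis of class sums of the class algebra. -/
noncomputable def connCoeff {n : ℕ} (lam mu nu : n.Partition) : ℂ :=
  (classSum_linearIndependent n).repr
    ⟨classSum lam * classSum mu, classSum_mul_mem_span lam mu⟩ nu

/-- `C_lam C_mu = ∑_nu c^nu_{lam mu} C_nu`. -/
theorem classSum_mul_classSum {n : ℕ} (lam mu : n.Partition) :
    classSum lam * classSum mu = ∑ nu, connCoeff lam mu nu • classSum nu := by
  have h := (classSum_linearIndependent n).linearCombination_repr
    ⟨classSum lam * classSum mu, classSum_mul_mem_span lam mu⟩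
  rw [Finsupp.linearCombination_apply, Finsupp.sum_fintype _ _ (by simp)] at h
  exact h.symm

/-- `c^nu_{lam mu}` is the number of factorizations `g = α β` of any given `g ∈ C_nu` with
`α ∈ C_lam` and `β ∈ C_mu`. -/
theorem connCoeff_eq_card {n : ℕ} (lam mu nu : n.Partition) {g : Equiv.Perm (Fin n)}
    (hg : g ∈ conjClass nu) :
    connCoeff lam mu nu =
      (((conjClass lam ×ˢ conjClass mu).filter fun q => q.1 * q.2 = g).card : ℂ) := by
  rw [← classSum_mul_coeff, classSum_mul_classSum, sum_smul_classSum_coeff, mem_conjClass.1 hg]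

/-- The number `ℓ(lam)` of parts of a partition. -/
def partLength {n : ℕ} (lam : n.Partition) : ℕ := lam.parts.card

/-- The coefficient `(n-ℓ(lam))! (n-ℓ(mu))! / (n+1-ℓ(lam)-ℓ(mu))!`, with the usual convention
`1 / k! = 0` for a negative integer `k`. -/
noncomputable def mvCoeff {n : ℕ} (lam mu : n.Partition) : ℂ :=
  if partLength lam + partLength mu ≤ n + 1 then
    (((n - partLength lam)! : ℕ) : ℂ) * (((n - partLength mu)! : ℕ) : ℂ) /
      (((n + 1 - (partLength lam + partLength mu))! : ℕ) : ℂ)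
  else 0

/-! Expand each power sum over colourings: `p` of the cycle type of α is the sum of the monomials of
all colourings of {0, …, n-1} constant on the cycles of α. After multiplication by (n-1)!, the
number of n-cycles, the coefficient of x^A y^B in ∑ c^n p p counts quadruples (α, β, f, g) with αβ
an n-cycle, f of content A constant on the cycles of α, and g of content B constant on the cycles of
β. The first identity says that this number depends only on the numbers k, l of colours used: it is
the falling factorial of n of length k+l-1, times (n-k)!(n-l)!.

The count goes through spanning trees. With J the all-ones matrix, det(1 - P + J) is n² for the
permutation matrix P of an n-cycle and 0 for any other permutation
(`det_one_sub_permMat_add_allOnes`). For fixed f and g, summing over the fibre-preserving α and β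
replaces their matrices by the averaging matrices of the fibres of f and g
(`sum_det_sub_permMat_mul`). By a Schur complement the resulting determinant is, up to explicit
factors, a cofactor of the signless Laplacian of the bipartite multigraph with edges f(i) - g(i),
that is, its number of spanning trees (`treeSum_mul_card_sq`).

It remains to sum cofactors over all n-tuples of edges. Adding one random weighted edge acts on
det(C + tL) as the operator z + d/dt, with z the total weight, so the sum over n-tuples is a
multiple of one cofactor of the complete bipartite graph with edge weights x_s y_t
(`sum_prod_mul_dotProduct_adjugate`, `treeSum_complete`). Its coefficients give the count.

For the second identity put y = (1, …, 1) with t ones. Then p_μ becomes t^ℓ(μ), and the coefficient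
of t¹ isolates μ = (n). On the other side falling factorials of t appear, and their linear
coefficients leave an alternating sum of binomials equal to 1 (`sum_lengthCoeff_mul`). -/

namespace Matrix

/-! ### Rank-one updates and sums of determinants over tuples of vectors -/

section CommRing

variable {ι R : Type*} [Fintype ι] [DecidableEq ι] [CommRing R]

/-- The entries of `v` are switched on one at a time, using linearity of the determinant in one
column. No invertibility of `A` is needed, which matters because the Laplacians below are singular.
-/
theorem det_add_vecMulVec (A : Matrix ι ι R) (u v : ι → R) :
    (A + vecMulVec u v).det = A.det + v ⬝ᵥ (A.adjugate *ᵥ u) := by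
  have key : ∀ s : Finset ι, (A + vecMulVec u (fun j => if j ∈ s then v j else 0)).det =
      A.det + ∑ j ∈ s, v j * (A.updateCol j u).det := by
    intro s
    induction s using Finset.induction_on with
    | empty =>
      simp only [Finset.notMem_empty, if_false, Finset.sum_empty, add_zero]
      congr 1
      ext i j
      simp [vecMulVec_apply]
    | insert a s ha ih =>
      set B := A + vecMulVec u (fun j => if j ∈ s then v j else 0) with hB
      have h1 : A + vecMulVec u (fun j => if j ∈ insert a s then v j else 0) =
          B.updateCol a (fun i => B i a + (v a • u) i) := by
        ext i j
        by_cases hj : j = a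
        · subst hj
          simp [hB, vecMulVec_apply, ha, mul_comm]
        · simp [hB, vecMulVec_apply, hj]
      -- The columns changed earlier differ from those of `A` by multiples of `u`, which is now
      -- column `a`, so column operations remove the change.
      have h2 : (B.updateCol a u).det = (A.updateCol a u).det := by
        rw [← det_transpose, ← det_transpose (A.updateCol a u)]
        refine det_eq_of_forall_row_eq_smul_add_const
          (fun j => if j ∈ s then v j else 0) a (by simp [ha]) ?_
        intro i j
        by_cases hi : i = a
        · subst hi
          simp [ha]
        · simp [hB, vecMulVec_apply, hi, mul_comm]
      have h3 : (B.updateCol a (fun i => B i a + (v a • u) i)).det =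
          B.det + v a * (B.updateCol a u).det := by
        have := det_updateCol_add B a (fun i => B i a) (v a • u)
        rw [det_updateCol_smul] at this
        refine Eq.trans this ?_
        congr 2
        exact updateCol_eq_self B a
      rw [h1, h3, h2, ih, Finset.sum_insert ha]
      ring
  have := key Finset.univ
  simp only [Finset.mem_univ, if_true] at this
  rw [this, ← cramer_eq_adjugate_mulVec]
  simp [dotProduct, cramer_apply]

theorem det_sub_vecMulVec (A : Matrix ι ι R) (u v : ι → R) :
    (A - vecMulVec u v).det = A.det - v ⬝ᵥ (A.adjugate *ᵥ u) := by
  have h : A - vecMulVec u v = A + vecMulVec (-u) v := by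
    rw [neg_vecMulVec, sub_eq_add_neg]
  rw [h, det_add_vecMulVec, mulVec_neg, dotProduct_neg, sub_eq_add_neg]

theorem derivative_det (M : Matrix ι ι (Polynomial R)) :
    Polynomial.derivative M.det = (M.adjugate * M.map Polynomial.derivative).trace := by
  have h1 : ∀ i, (M.adjugate * M.map Polynomial.derivative) i i =
      (M.updateCol i (fun k => Polynomial.derivative (M k i))).det := by
    intro i
    have := congrFun (cramer_eq_adjugate_mulVec M (fun k => Polynomial.derivative (M k i))) i
    rw [cramer_apply] at this
    rw [this]
    rfl
  simp only [trace, diag_apply, h1, det_apply]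
  rw [Finset.sum_comm, Polynomial.derivative_sum]
  refine Finset.sum_congr rfl fun p _ => ?_
  rw [← Finset.smul_sum]
  have h2 : ∀ (z : ℤˣ) (q : Polynomial R),
      Polynomial.derivative (z • q) = z • Polynomial.derivative q := by
    intro z q
    rcases Int.units_eq_one_or z with rfl | rfl <;> simp
  rw [h2, Polynomial.derivative_prod_finset]
  congr 1
  refine Finset.sum_congr rfl fun i _ => ?_
  rw [← Finset.mul_prod_erase Finset.univ _ (Finset.mem_univ i), mul_comm]
  congr 1
  · simp
  · refine Finset.prod_congr rfl fun j hj => ?_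
    rw [updateCol_ne (Finset.ne_of_mem_erase hj)]

/-- The polynomial `det (C + t L)`. -/
noncomputable def detPencil (C L : Matrix ι ι R) : Polynomial R :=
  (C.map Polynomial.C + (Polynomial.X : Polynomial R) • L.map Polynomial.C).det

theorem detPencil_add_vecMulVec (C L : Matrix ι ι R) (r : ι → R) :
    detPencil (C + vecMulVec r r) L = detPencil C L +
      (fun i => Polynomial.C (r i)) ⬝ᵥ
        ((C.map Polynomial.C + (Polynomial.X : Polynomial R) • L.map Polynomial.C).adjugate *ᵥ
          fun i => Polynomial.C (r i)) := by
  rw [detPencil, detPencil, ← det_add_vecMulVec]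
  congr 1
  ext1 i j
  simp [vecMulVec_apply]
  ring

theorem derivative_detPencil {κ : Type*} [Fintype κ] (C : Matrix ι ι R) (w : κ → R)
    (r : κ → ι → R) :
    Polynomial.derivative (detPencil C (∑ a, w a • vecMulVec (r a) (r a))) =
      ∑ a, w a • ((fun i => Polynomial.C (r a i)) ⬝ᵥ
        ((C.map Polynomial.C + (Polynomial.X : Polynomial R) •
          (∑ a, w a • vecMulVec (r a) (r a)).map Polynomial.C).adjugate *ᵥ
          fun i => Polynomial.C (r a i))) := by
  rw [detPencil, derivative_det]
  set L := ∑ a, w a • vecMulVec (r a) (r a) with hL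
  set A := (C.map Polynomial.C + (Polynomial.X : Polynomial R) • L.map Polynomial.C).adjugate
  have h1 : (C.map Polynomial.C + (Polynomial.X : Polynomial R) • L.map Polynomial.C).map
      Polynomial.derivative = L.map Polynomial.C := by
    ext1 i j
    simp
  rw [h1]
  have h2 : L.map Polynomial.C = ∑ a, w a • vecMulVec (fun i => Polynomial.C (r a i))
      (fun i => Polynomial.C (r a i)) := by
    ext1 i j
    simp [hL, Matrix.sum_apply, vecMulVec_apply, Polynomial.smul_eq_C_mul]
  rw [h2, Finset.mul_sum, trace_sum]
  refine Finset.sum_congr rfl fun a _ => ?_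
  rw [Matrix.mul_smul, trace_smul, mul_vecMulVec, trace_vecMulVec, dotProduct_comm]

/-- The operator `z + d/dX` on polynomials. -/
noncomputable def derivShift (z : R) : Module.End R (Polynomial R) :=
  z • LinearMap.id + Polynomial.derivative

theorem derivShift_apply (z : R) (p : Polynomial R) :
    derivShift z p = z • p + Polynomial.derivative p := rfl

/-- The sum of `det (C + ∑ r rᵀ)` over all `n`-tuples of weighted vectors `r`. -/
theorem sum_prod_mul_det_add_sum_vecMulVec {κ : Type*} [Fintype κ] (w : κ → R) (r : κ → ι → R)
    (n : ℕ) (C : Matrix ι ι R) :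
    ∑ h : Fin n → κ, (∏ i, w (h i)) * (C + ∑ i, vecMulVec (r (h i)) (r (h i))).det =
      ((derivShift (∑ a, w a) ^ n) (detPencil C (∑ a, w a • vecMulVec (r a) (r a)))).eval 0 := by
  induction n generalizing C with
  | zero =>
    simp only [Finset.univ_unique, Finset.univ_eq_empty, Finset.prod_empty, Finset.sum_empty,
      add_zero, one_mul, Finset.sum_const, Finset.card_singleton, one_smul, pow_zero,
      Module.End.one_apply, detPencil]
    rw [← Polynomial.coe_evalRingHom, RingHom.map_det]
    congr 1
    ext i j
    simp
  | succ n ih =>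
    rw [← (Fin.consEquiv fun _ => κ).sum_comp, Fintype.sum_prod_type]
    have h1 : ∀ a, ∑ h : Fin n → κ, (∏ i, w ((Fin.consEquiv fun _ => κ) (a, h) i)) *
        (C + ∑ i, vecMulVec (r ((Fin.consEquiv fun _ => κ) (a, h) i))
          (r ((Fin.consEquiv fun _ => κ) (a, h) i))).det =
        w a * ∑ h : Fin n → κ, (∏ i, w (h i)) *
          ((C + vecMulVec (r a) (r a)) + ∑ i, vecMulVec (r (h i)) (r (h i))).det := by
      intro a
      rw [Finset.mul_sum]
      refine Finset.sum_congr rfl fun h _ => ?_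
      simp [Fin.consEquiv, Fin.prod_univ_succ, Fin.sum_univ_succ, mul_assoc, add_assoc]
    simp only [h1, ih]
    rw [pow_succ, Module.End.mul_apply]
    -- Averaging over the first vector applies `z + d/dX` to the pencil: its rank-one corrections
    -- add up, by Jacobi's formula, to the derivative, since `L` is the weighted sum of the same
    -- rank-one matrices.
    have h2 : derivShift (∑ a, w a) (detPencil C (∑ a, w a • vecMulVec (r a) (r a))) =
        ∑ a, w a • detPencil (C + vecMulVec (r a) (r a)) (∑ a, w a • vecMulVec (r a) (r a)) := by
      simp only [detPencil_add_vecMulVec, smul_add, Finset.sum_add_distrib, derivShift_apply,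
        Finset.sum_smul]
      rw [← derivative_detPencil]
    rw [h2, map_sum, Polynomial.eval_finsetSum]
    simp

/-- Binomial theorem for the commuting operators `d/dX` and `z`; the k-th derivative at 0 is k!
times the k-th coefficient. -/
theorem eval_zero_derivShift_pow (z : R) (n : ℕ) (p : Polynomial R) :
    ((derivShift z ^ n) p).eval 0 =
      ∑ k ∈ Finset.range (n + 1), (n.descFactorial k : R) * z ^ (n - k) * p.coeff k := by
  have hd : derivShift z = (Polynomial.derivative : Module.End R (Polynomial R)) +
      z • (1 : Module.End R (Polynomial R)) := by
    rw [add_comm]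
    rfl
  have hc : Commute (Polynomial.derivative : Module.End R (Polynomial R))
      (z • (1 : Module.End R (Polynomial R))) := (Commute.one_right _).smul_right z
  rw [hd, hc.add_pow, LinearMap.sum_apply, Polynomial.eval_finsetSum]
  refine Finset.sum_congr rfl fun k _ => ?_
  have h1 : ((Polynomial.derivative : Module.End R (Polynomial R)) ^ k *
      (z • (1 : Module.End R (Polynomial R))) ^ (n - k) *
        (n.choose k : Module.End R (Polynomial R))) p =
      (z ^ (n - k) * (n.choose k : R)) • Polynomial.derivative^[k] p := by
    rw [Module.End.mul_apply, Module.End.mul_apply, smul_pow, one_pow, LinearMap.smul_apply,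
      Module.End.one_apply, map_smul, Module.End.pow_apply, Module.End.natCast_apply,
      mul_smul, Nat.cast_smul_eq_nsmul, ← Module.End.pow_apply, map_nsmul, Module.End.pow_apply]
  rw [h1, Polynomial.eval_smul, ← Polynomial.coeff_zero_eq_eval_zero,
    Polynomial.coeff_iterate_derivative, zero_add, Nat.descFactorial_self, smul_eq_mul,
    nsmul_eq_mul, Nat.descFactorial_eq_factorial_mul_choose]
  push_cast
  ring

/-- As `L` is singular, the rank-one update leaves only the adjugate term, a single power of the
variable. -/
theorem detPencil_vecMulVec (e : ι → R) (L : Matrix ι ι R) (hL : L.det = 0) :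
    detPencil (vecMulVec e e) L =
      Polynomial.C (e ⬝ᵥ (L.adjugate *ᵥ e)) * Polynomial.X ^ (Fintype.card ι - 1) := by
  have h1 : (vecMulVec e e).map Polynomial.C =
      vecMulVec (fun i => Polynomial.C (e i)) (fun i => Polynomial.C (e i)) := by
    ext1 i j
    simp [vecMulVec_apply]
  have h2 : (L.map Polynomial.C).det = 0 := by
    rw [← RingHom.mapMatrix_apply, ← RingHom.map_det, hL, map_zero]
  have h3 : (L.map Polynomial.C).adjugate = L.adjugate.map Polynomial.C := by
    rw [← RingHom.mapMatrix_apply, ← RingHom.map_adjugate, RingHom.mapMatrix_apply]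
  rw [detPencil, h1, add_comm, det_add_vecMulVec, det_smul, h2, mul_zero, zero_add,
    adjugate_smul, h3, smul_mulVec, dotProduct_smul, smul_eq_mul, mul_comm]
  congr 1
  simp [dotProduct, mulVec]

/-- Take `C = e eᵀ` in the sum over tuples: for singular matrices the determinant becomes the
cofactor form `eᵀ adj e`, and the pencil has one nonzero coefficient at most, so only one term of
the binomial expansion survives. -/
theorem sum_prod_mul_dotProduct_adjugate {κ : Type*} [Fintype κ] (w : κ → R) (r : κ → ι → R)
    (e : ι → R) (n : ℕ) (h0 : (∑ a, w a • vecMulVec (r a) (r a)).det = 0)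
    (h0' : ∀ h : Fin n → κ, (∑ i, vecMulVec (r (h i)) (r (h i))).det = 0) :
    ∑ h : Fin n → κ, (∏ i, w (h i)) *
        (e ⬝ᵥ ((∑ i, vecMulVec (r (h i)) (r (h i))).adjugate *ᵥ e)) =
      (n.descFactorial (Fintype.card ι - 1) : R) * (∑ a, w a) ^ (n - (Fintype.card ι - 1)) *
        (e ⬝ᵥ ((∑ a, w a • vecMulVec (r a) (r a)).adjugate *ᵥ e)) := by
  have h1 := sum_prod_mul_det_add_sum_vecMulVec w r n (vecMulVec e e)
  rw [detPencil_vecMulVec e _ h0, eval_zero_derivShift_pow] at h1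
  have h2 : ∀ h : Fin n → κ, (vecMulVec e e + ∑ i, vecMulVec (r (h i)) (r (h i))).det =
      e ⬝ᵥ ((∑ i, vecMulVec (r (h i)) (r (h i))).adjugate *ᵥ e) := by
    intro h
    rw [add_comm, det_add_vecMulVec, h0', zero_add]
  simp only [h2] at h1
  rw [h1]
  simp only [Polynomial.coeff_C_mul, Polynomial.coeff_X_pow]
  by_cases hm : Fintype.card ι - 1 ∈ Finset.range (n + 1)
  · rw [Finset.sum_eq_single_of_mem _ hm]
    · simp
    · intro b _ hb
      simp [hb]
  -- With too few vectors the degree is out of range, and the falling factorial vanishes too.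
  · rw [Finset.sum_eq_zero, Nat.descFactorial_eq_zero_iff_lt.2]
    · simp
    · rw [Finset.mem_range] at hm
      omega
    · intro b hb
      have : b ≠ Fintype.card ι - 1 := fun h => hm (h ▸ hb)
      simp [this]

end CommRing

section IsDomain

variable {ι R : Type*} [Fintype ι] [DecidableEq ι] [CommRing R] [IsDomain R]

/-- The quantity is det(P + u wᵀ) - det P, and both matrices kill `k`. -/
theorem dotProduct_adjugate_eq_zero {P : Matrix ι ι R} {k : ι → R} (hk : k ≠ 0)
    (hP : P *ᵥ k = 0) (u : ι → R) {w : ι → R} (hw : w ⬝ᵥ k = 0) :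
    w ⬝ᵥ (P.adjugate *ᵥ u) = 0 := by
  have h0 : P.det = 0 := exists_mulVec_eq_zero_iff.1 ⟨k, hk, hP⟩
  have h1 : (P + vecMulVec u w).det = 0 :=
    exists_mulVec_eq_zero_iff.1 ⟨k, hk, by
      rw [add_mulVec, hP, vecMulVec_mulVec, hw]; simp⟩
  rw [det_add_vecMulVec, h0, zero_add] at h1
  exact h1

/-- The adjugate of a matrix with kernel and cokernel spanned by `k` is a multiple of `k kᵀ`. -/
theorem dotProduct_adjugate_mul_eq {P : Matrix ι ι R} {k : ι → R} (hk : k ≠ 0)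
    (hP : P *ᵥ k = 0) (hP' : k ᵥ* P = 0) (u v u' v' : ι → R) :
    v ⬝ᵥ (P.adjugate *ᵥ u) * ((u' ⬝ᵥ k) * (v' ⬝ᵥ k)) =
      v' ⬝ᵥ (P.adjugate *ᵥ u') * ((u ⬝ᵥ k) * (v ⬝ᵥ k)) := by
  have h1 : ∀ a b c : ι → R, b ⬝ᵥ (P.adjugate *ᵥ a) * (c ⬝ᵥ k) =
      c ⬝ᵥ (P.adjugate *ᵥ a) * (b ⬝ᵥ k) := by
    intro a b c
    have := dotProduct_adjugate_eq_zero hk hP a (w := (c ⬝ᵥ k) • b - (b ⬝ᵥ k) • c) (by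
      simp only [sub_dotProduct, smul_dotProduct, smul_eq_mul]; ring)
    simp only [sub_dotProduct, smul_dotProduct, smul_eq_mul] at this
    linear_combination this
  have hT : ∀ a b : ι → R, b ⬝ᵥ (P.adjugate *ᵥ a) = a ⬝ᵥ (Pᵀ.adjugate *ᵥ b) := by
    intro a b
    rw [← adjugate_transpose, mulVec_transpose, dotProduct_mulVec, dotProduct_comm]
  have hPT : Pᵀ *ᵥ k = 0 := by rw [mulVec_transpose, hP']
  have h2 : ∀ a b c : ι → R, b ⬝ᵥ (P.adjugate *ᵥ a) * (c ⬝ᵥ k) =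
      b ⬝ᵥ (P.adjugate *ᵥ c) * (a ⬝ᵥ k) := by
    intro a b c
    have := dotProduct_adjugate_eq_zero hk hPT b (w := (c ⬝ᵥ k) • a - (a ⬝ᵥ k) • c) (by
      simp only [sub_dotProduct, smul_dotProduct, smul_eq_mul]; ring)
    rw [← hT] at this
    simp only [mulVec_sub, mulVec_smul, dotProduct_sub, dotProduct_smul, smul_eq_mul] at this
    linear_combination this
  linear_combination (v' ⬝ᵥ k) * h2 u v u' + (u ⬝ᵥ k) * h1 u' v v'

end IsDomain

end Matrix

namespace Matrix

/-! ### Cofactors of bipartite signless Laplacians -/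

section Bipartite

variable {σ τ R : Type*} [Fintype σ] [DecidableEq σ] [Fintype τ] [DecidableEq τ] [CommRing R]

/-- The incidence vector of the edge `s - t` in the complete bipartite graph on `σ ⊕ τ`. -/
def edgeVec (R : Type*) [CommRing R] (a : σ × τ) : σ ⊕ τ → R :=
  Sum.elim (Pi.single a.1 1) (Pi.single a.2 1)

/-- The vector spanning the kernel of a bipartite signless Laplacian. -/
def signVec (σ τ R : Type*) [CommRing R] : σ ⊕ τ → R := Sum.elim 1 (-1)

theorem edgeVec_dotProduct_signVec (a : σ × τ) :
    edgeVec R a ⬝ᵥ signVec σ τ R = 0 := by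
  simp [edgeVec, signVec, dotProduct, Pi.single_apply]

theorem sum_vecMulVec_edgeVec_mulVec {κ : Type*} [Fintype κ] (w : κ → R) (e : κ → σ × τ) :
    (∑ i, w i • vecMulVec (edgeVec R (e i)) (edgeVec R (e i))) *ᵥ signVec σ τ R = 0 := by
  rw [Matrix.sum_mulVec]
  refine Finset.sum_eq_zero fun i _ => ?_
  rw [smul_mulVec, vecMulVec_mulVec, edgeVec_dotProduct_signVec]
  simp

theorem vecMul_sum_vecMulVec_edgeVec {κ : Type*} [Fintype κ] (w : κ → R) (e : κ → σ × τ) :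
    signVec σ τ R ᵥ* (∑ i, w i • vecMulVec (edgeVec R (e i)) (edgeVec R (e i))) = 0 := by
  rw [Matrix.vecMul_sum]
  refine Finset.sum_eq_zero fun i _ => ?_
  rw [vecMul_smul, vecMul_vecMulVec, dotProduct_comm, edgeVec_dotProduct_signVec]
  simp

theorem signVec_ne_zero [Nontrivial R] [Nonempty σ] : signVec σ τ R ≠ 0 := fun h => by
  obtain ⟨s⟩ := ‹Nonempty σ›
  simpa [signVec] using congrFun h (Sum.inl s)

theorem det_sum_vecMulVec_edgeVec [IsDomain R] [Nonempty σ] {κ : Type*} [Fintype κ] (w : κ → R)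
    (e : κ → σ × τ) :
    (∑ i, w i • vecMulVec (edgeVec R (e i)) (edgeVec R (e i))).det = 0 :=
  exists_mulVec_eq_zero_iff.1 ⟨_, signVec_ne_zero, sum_vecMulVec_edgeVec_mulVec w e⟩

/-- The common value of all cofactors (up to sign) of the signless Laplacian of a weighted
bipartite multigraph with edges `e i` of weight `w i`, computed at the vertex `s₀`. -/
noncomputable def treeSum {κ : Type*} [Fintype κ] (s₀ : σ) (w : κ → R) (e : κ → σ × τ) : R :=
  Pi.single (Sum.inl s₀) 1 ⬝ᵥ
    ((∑ i, w i • vecMulVec (edgeVec R (e i)) (edgeVec R (e i))).adjugate *ᵥ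
      Pi.single (Sum.inl s₀) 1)

/-- The adjugate is proportional to `k kᵀ` with `k = signVec`, so any two test vectors detect the
cofactor. Here one lives on `σ` and one on `τ`, so the correction only touches an off-diagonal
block; their pairings with `k` have opposite signs, whence the minus sign. The free choice of `x`
and `y` is used twice below. -/
theorem treeSum_mul_eq_det_sub_vecMulVec [IsDomain R] {κ : Type*} [Fintype κ] (s₀ : σ)
    (w : κ → R) (e : κ → σ × τ) (x : σ → R) (y : τ → R) :
    treeSum s₀ w e * ((∑ s, x s) * ∑ t, y t) =
      (∑ i, w i • vecMulVec (edgeVec R (e i)) (edgeVec R (e i)) -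
        vecMulVec (Sum.elim x 0) (Sum.elim 0 y)).det := by
  have : Nonempty σ := ⟨s₀⟩
  have h := dotProduct_adjugate_mul_eq (signVec_ne_zero (σ := σ) (τ := τ) (R := R))
    (sum_vecMulVec_edgeVec_mulVec w e) (vecMul_sum_vecMulVec_edgeVec w e)
    (Sum.elim x 0) (Sum.elim 0 y) (Pi.single (Sum.inl s₀) 1) (Pi.single (Sum.inl s₀) 1)
  have h1 : (Pi.single (Sum.inl s₀) 1 : σ ⊕ τ → R) ⬝ᵥ signVec σ τ R = 1 := by
    simp [signVec]
  have h2 : (Sum.elim x 0 : σ ⊕ τ → R) ⬝ᵥ signVec σ τ R = ∑ s, x s := by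
    simp [signVec, dotProduct]
  have h3 : (Sum.elim 0 y : σ ⊕ τ → R) ⬝ᵥ signVec σ τ R = -∑ t, y t := by
    simp [signVec, dotProduct]
  rw [h1, h2, h3] at h
  rw [det_sub_vecMulVec, det_sum_vecMulVec_edgeVec, treeSum]
  linear_combination h

/-- The signless Laplacian as a block matrix. -/
theorem sum_vecMulVec_edgeVec_eq_fromBlocks {κ : Type*} [Fintype κ] (w : κ → R)
    (e : κ → σ × τ) :
    ∑ i, w i • vecMulVec (edgeVec R (e i)) (edgeVec R (e i)) =
      fromBlocks (diagonal fun s => ∑ i, if (e i).1 = s then w i else 0)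
        (of fun s t => ∑ i, if (e i).1 = s ∧ (e i).2 = t then w i else 0)
        (of fun t s => ∑ i, if (e i).1 = s ∧ (e i).2 = t then w i else 0)
        (diagonal fun t => ∑ i, if (e i).2 = t then w i else 0) := by
  ext a b
  rw [Matrix.sum_apply]
  rcases a with a | a <;> rcases b with b | b
  · by_cases h : a = b
    · subst h
      simp only [fromBlocks_apply₁₁, fromBlocks_apply₂₂, diagonal_apply_eq]
      refine Finset.sum_congr rfl fun i _ => ?_
      simp [vecMulVec_apply, edgeVec, Pi.single_apply]
      grind
    · simp only [fromBlocks_apply₁₁, diagonal_apply_ne _ h]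
      refine Finset.sum_eq_zero fun i _ => ?_
      simp [vecMulVec_apply, edgeVec, Pi.single_apply]
      grind
  · simp only [fromBlocks_apply₁₂, of_apply]
    refine Finset.sum_congr rfl fun i _ => ?_
    simp [vecMulVec_apply, edgeVec, Pi.single_apply]
    grind
  · simp only [fromBlocks_apply₂₁, of_apply]
    refine Finset.sum_congr rfl fun i _ => ?_
    simp [vecMulVec_apply, edgeVec, Pi.single_apply]
    grind
  · by_cases h : a = b
    · subst h
      simp only [fromBlocks_apply₁₁, fromBlocks_apply₂₂, diagonal_apply_eq]
      refine Finset.sum_congr rfl fun i _ => ?_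
      simp [vecMulVec_apply, edgeVec, Pi.single_apply]
      grind
    · simp only [fromBlocks_apply₂₂, diagonal_apply_ne _ h]
      refine Finset.sum_eq_zero fun i _ => ?_
      simp [vecMulVec_apply, edgeVec, Pi.single_apply]
      grind

/-- The weighted count of spanning trees of a complete bipartite graph. -/
theorem treeSum_complete [IsDomain R] (s₀ : σ) (x : σ → R) (y : τ → R) :
    treeSum s₀ (fun a : σ × τ => x a.1 * y a.2) id * ((∑ s, x s) * ∑ t, y t) =
      (∏ s, x s) * (∏ t, y t) * (∑ t, y t) ^ Fintype.card σ * (∑ s, x s) ^ Fintype.card τ := by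
  rw [treeSum_mul_eq_det_sub_vecMulVec, sum_vecMulVec_edgeVec_eq_fromBlocks]
  have h1 : ∀ s, (∑ i : σ × τ, if (id i).1 = s then x i.1 * y i.2 else 0) =
      x s * ∑ t, y t := by
    intro s
    rw [Fintype.sum_prod_type_right]
    simp [Finset.mul_sum]
  have h2 : ∀ t, (∑ i : σ × τ, if (id i).2 = t then x i.1 * y i.2 else 0) =
      y t * ∑ s, x s := by
    intro t
    rw [Fintype.sum_prod_type]
    simp [Finset.mul_sum, mul_comm]
  have h3 : ∀ s t, (∑ i : σ × τ, if (id i).1 = s ∧ (id i).2 = t then x i.1 * y i.2 else 0) =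
      x s * y t := by
    intro s t
    rw [Finset.sum_eq_single (s, t)]
    · simp
    · rintro ⟨a, b⟩ _ hab
      rw [if_neg]
      rintro ⟨rfl, rfl⟩
      exact hab rfl
    · simp
  simp only [h1, h2, h3]
  -- With the vertex weights as `x` and `y`, the correction is exactly the upper right block, and
  -- the difference becomes block triangular.
  have h4 : (vecMulVec (Sum.elim x 0) (Sum.elim 0 y) : Matrix (σ ⊕ τ) (σ ⊕ τ) R) =
      fromBlocks 0 (of fun s t => x s * y t) 0 0 := by
    ext a b
    rcases a with a | a <;> rcases b with b | b <;> simp [vecMulVec_apply]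
  rw [h4, sub_eq_add_neg, fromBlocks_neg, fromBlocks_add, add_neg_cancel, det_fromBlocks_zero₁₂]
  simp only [neg_zero, add_zero, det_diagonal, Finset.prod_mul_distrib, Finset.prod_const,
    Finset.card_univ]
  ring

end Bipartite

/-! ### Averaging determinants over Young subgroups -/

section Averaging

variable {ι σ : Type*} [Fintype ι] [DecidableEq ι] [DecidableEq σ]

/-- The permutation matrix of `g` sending the basis vector `e_j` to `e_{g j}`. -/
def permMat (R : Type*) [CommRing R] (g : Equiv.Perm ι) : Matrix ι ι R :=
  of fun i j => if i = g j then 1 else 0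

/-- The number of points of each fibre of `f`. -/
def fiberCard (f : ι → σ) (s : σ) : ℕ := (Finset.univ.filter fun i => f i = s).card

/-- The matrix averaging over the fibres of `f`. -/
def fiberAvg (K : Type*) [Field K] (f : ι → σ) : Matrix ι ι K :=
  of fun i j => if f i = f j then (fiberCard f (f i) : K)⁻¹ else 0

/-- The permutations preserving all fibres of `f`. -/
def fiberPerms (f : ι → σ) : Finset (Equiv.Perm ι) :=
  Finset.univ.filter fun g => ∀ i, f (g i) = f i

theorem mem_fiberPerms {f : ι → σ} {g : Equiv.Perm ι} :
    g ∈ fiberPerms f ↔ ∀ i, f (g i) = f i := by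
  simp [fiberPerms]

theorem permMat_mul {R : Type*} [CommRing R] (g h : Equiv.Perm ι) :
    permMat R (g * h) = permMat R g * permMat R h := by
  ext i j
  rw [mul_apply, Finset.sum_eq_single (h j)]
  · simp only [permMat, of_apply, if_true, mul_one]
    rfl
  · intro k _ hk
    simp [permMat, hk]
  · simp

theorem permMat_swap {R : Type*} [CommRing R] {i j : ι} (h : i ≠ j) :
    permMat R (Equiv.swap i j) =
      1 - vecMulVec (Pi.single i 1 - Pi.single j 1) (Pi.single i 1 - Pi.single j 1) := by
  ext a b
  simp only [permMat, of_apply, sub_apply, one_apply, vecMulVec_apply, Pi.sub_apply,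
    Pi.single_apply, Equiv.swap_apply_def]
  grind

/-- Replacing rows `i`, `j` of `M` by rows with the same sum does not change the average of
`det (C - g M)` over a set of permutations `g` stable under the transposition of `i` and `j`. -/
theorem two_mul_sum_det_sub_permMat_mul {R : Type*} [CommRing R] {H : Finset (Equiv.Perm ι)}
    {i j : ι} (hij : i ≠ j) (hH : ∀ g ∈ H, g * Equiv.swap i j ∈ H) (C M : Matrix ι ι R)
    (u : ι → R) :
    2 * ∑ g ∈ H, (C - permMat R g * (M + vecMulVec (Pi.single i 1 - Pi.single j 1) u)).det =
      2 * ∑ g ∈ H, (C - permMat R g * M).det := by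
  -- Pair `g` with `g * swap i j`; each element is then counted twice.
  have hswap : ∀ N : Matrix ι ι R, 2 * ∑ g ∈ H, (C - permMat R g * N).det =
      ∑ g ∈ H, ((C - permMat R g * N).det +
        (C - permMat R (g * Equiv.swap i j) * N).det) := by
    intro N
    rw [Finset.sum_add_distrib, two_mul]
    congr 1
    refine Finset.sum_nbij' (fun g => g * Equiv.swap i j) (fun g => g * Equiv.swap i j)
      hH hH ?_ ?_ ?_ <;> intro g _ <;> simp [mul_assoc]
  rw [hswap, hswap]
  refine Finset.sum_congr rfl fun g _ => ?_
  set δ : ι → R := Pi.single i 1 - Pi.single j 1 with hδ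
  set ε := permMat R g *ᵥ δ with hε
  set X := C - permMat R g * M with hX
  have hdd : δ ⬝ᵥ δ = 2 := by
    simp [hδ, hij, hij.symm]
    norm_num
  have h1 : C - permMat R g * (M + vecMulVec δ u) = X + vecMulVec ε (-u) := by
    rw [mul_add, mul_vecMulVec, ← hε, vecMulVec_neg, hX]
    abel
  have h2 : C - permMat R (g * Equiv.swap i j) * M = X + vecMulVec ε (δ ᵥ* M) := by
    rw [permMat_mul, permMat_swap hij, ← hδ, mul_sub, mul_one, sub_mul, mul_vecMulVec,
      vecMulVec_mul, ← hε, hX]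
    abel
  have h3 : C - permMat R (g * Equiv.swap i j) * (M + vecMulVec δ u) =
      X + vecMulVec ε (δ ᵥ* M + u) := by
    rw [mul_add, ← sub_sub, h2, permMat_mul, permMat_swap hij, ← hδ, mul_vecMulVec,
      ← mulVec_mulVec, sub_mulVec, one_mulVec, vecMulVec_mulVec, hdd, vecMulVec_add]
    have : permMat R g *ᵥ (δ - MulOpposite.op (2 : R) • δ) = -ε := by
      rw [hε, ← mulVec_neg]
      congr 1
      ext k
      simp only [Pi.sub_apply, Pi.smul_apply, MulOpposite.smul_eq_mul_unop,
        MulOpposite.unop_op, Pi.neg_apply]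
      ring
    rw [this, neg_vecMulVec]
    abel
  -- All four matrices are `X` plus `ε` times a row, and the determinant is affine in that row. The
  -- rows `-u` and `δᵀM + u` have the same sum as `0` and `δᵀM`; the sign flip of `u` comes from `δ
  -- ⬝ᵥ δ = 2`, as the swap is a reflection in `δ`.
  rw [h1, h2, h3]
  simp only [det_add_vecMulVec, add_dotProduct, neg_dotProduct]
  ring

variable {K : Type*} [Field K] [CharZero K]

theorem fiberCard_apply_ne_zero (f : ι → σ) (i : ι) : (fiberCard f (f i) : K) ≠ 0 := by
  rw [Nat.cast_ne_zero, fiberCard, Finset.card_ne_zero]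
  exact ⟨i, by simp⟩

theorem permMat_mul_fiberAvg {f : ι → σ} {g : Equiv.Perm ι} (hg : g ∈ fiberPerms f) :
    permMat K g * fiberAvg K f = fiberAvg K f := by
  rw [mem_fiberPerms] at hg
  ext i j
  have h1 : f (g.symm i) = f i := by
    have := hg (g.symm i)
    rwa [Equiv.apply_symm_apply, eq_comm] at this
  have h2 : ∀ k, i = g k ↔ g.symm i = k := fun k => Equiv.symm_apply_eq g |>.symm
  rw [mul_apply, Finset.sum_eq_single (g.symm i)]
  · simp [permMat, fiberAvg, h1]
  · intro k _ hk
    simp [permMat, h2, Ne.symm hk]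
  · simp

/-- `M` is reached from its fibrewise row average by transfers between two rows of one fibre,
precisely the moves under which the averaged determinant is invariant. -/
theorem eq_fiberAvg_mul_add_sum (f : ι → σ) (M : Matrix ι ι K) :
    M = fiberAvg K f * M + ∑ p ∈ Finset.univ.filter (fun p : ι × ι => f p.1 = f p.2),
      vecMulVec (Pi.single p.1 1 - Pi.single p.2 1)
        ((fiberCard f (f p.1) : K)⁻¹ • M p.1) := by
  rw [Finset.sum_filter, Fintype.sum_prod_type]
  ext a b
  rw [add_apply, Matrix.sum_apply]
  simp only [Matrix.sum_apply, mul_apply, fiberAvg, of_apply]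
  have h1 : ∀ i, ∑ j, (if f i = f j then vecMulVec (Pi.single i 1 - Pi.single j 1)
      ((fiberCard f (f i) : K)⁻¹ • M i) else 0) a b =
      (if a = i then M a b else 0) -
        (if f a = f i then (fiberCard f (f a) : K)⁻¹ else 0) * M i b := by
    intro i
    have h2 : ∀ j, (if f i = f j then vecMulVec (Pi.single i 1 - Pi.single j 1)
        ((fiberCard f (f i) : K)⁻¹ • M i) else 0) a b =
        (if f j = f i then 1 else 0) *
            ((if a = i then 1 else 0) * ((fiberCard f (f i) : K)⁻¹ * M i b)) -
          (if a = j then (if f i = f a then (fiberCard f (f i) : K)⁻¹ * M i b else 0) else 0) := by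
      intro j
      by_cases h : f i = f j
      · rw [if_pos h, if_pos h.symm, vecMulVec_apply]
        by_cases ha : a = j
        · subst ha
          simp [h, Pi.single_apply, sub_mul]
        · simp [Pi.single_apply, ha]
      · rw [if_neg h, if_neg (Ne.symm h)]
        by_cases ha : a = j
        · subst ha
          simp [h]
        · simp [ha]
    simp only [h2, Finset.sum_sub_distrib, ← Finset.sum_mul, Finset.sum_boole]
    change (fiberCard f (f i) : K) * _ - _ = _
    congr 1
    · split_ifs with h
      · subst h
        rw [one_mul, mul_inv_cancel_left₀ (fiberCard_apply_ne_zero f a)]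
      · simp
    · simp only [Finset.sum_ite_eq, Finset.mem_univ, if_true]
      by_cases h : f i = f a
      · simp [h]
      · simp [h, Ne.symm h]
  simp only [h1, Finset.sum_sub_distrib]
  simp

/-- Averaging over the permutations preserving the fibres of `f` commutes with `det (C - · M)`. -/
theorem sum_det_sub_permMat_mul (f : ι → σ) (C M : Matrix ι ι K) :
    ∑ g ∈ fiberPerms f, (C - permMat K g * M).det =
      (fiberPerms f).card * (C - fiberAvg K f * M).det := by
  have key : ∀ s : Finset (ι × ι), (∀ p ∈ s, f p.1 = f p.2) →
      ∑ g ∈ fiberPerms f, (C - permMat K g * (fiberAvg K f * M +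
        ∑ p ∈ s, vecMulVec (Pi.single p.1 1 - Pi.single p.2 1)
          ((fiberCard f (f p.1) : K)⁻¹ • M p.1))).det =
      (fiberPerms f).card * (C - fiberAvg K f * M).det := by
    intro s
    induction s using Finset.induction_on with
    | empty =>
      intro _
      rw [Finset.sum_empty, add_zero, Finset.card_eq_sum_ones, Nat.cast_sum, Finset.sum_mul]
      refine Finset.sum_congr rfl fun g hg => ?_
      rw [← Matrix.mul_assoc, permMat_mul_fiberAvg hg, Nat.cast_one, one_mul]
    | insert p s hp ih =>
      intro hs
      have hs' := ih fun q hq => hs q (Finset.mem_insert_of_mem hq)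
      rw [Finset.sum_insert hp, add_comm (vecMulVec _ _), ← add_assoc]
      by_cases hpp : p.1 = p.2
      · rw [hpp, sub_self, zero_vecMulVec, add_zero, hs']
      · have hf := hs p (Finset.mem_insert_self _ _)
        have h2 := two_mul_sum_det_sub_permMat_mul (H := fiberPerms f) hpp (fun g hg => by
          rw [mem_fiberPerms] at hg ⊢
          intro k
          rw [Equiv.Perm.mul_apply, hg, Equiv.swap_apply_def]
          split_ifs with h1 h2
          · rw [h1, hf]
          · rw [h2, hf]
          · rfl) C (fiberAvg K f * M + ∑ p ∈ s, vecMulVec (Pi.single p.1 1 - Pi.single p.2 1)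
            ((fiberCard f (f p.1) : K)⁻¹ • M p.1)) ((fiberCard f (f p.1) : K)⁻¹ • M p.1)
        rw [← hs']
        exact mul_left_cancel₀ two_ne_zero h2
  conv_lhs => rw [eq_fiberAvg_mul_add_sum f M]
  exact key _ fun p hp => (Finset.mem_filter.1 hp).2

end Averaging

end Matrix

namespace Matrix

/-! ### From averaged determinants to spanning trees -/

section Schur

variable {ι σ τ K : Type*} [Fintype ι] [DecidableEq ι] [Fintype σ] [DecidableEq σ] [Fintype τ]
  [DecidableEq τ] [Field K] [CharZero K]

/-- The matrix all of whose entries are one. -/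
def allOnes (ι R : Type*) [CommRing R] : Matrix ι ι R := vecMulVec 1 1

/-- The indicator matrix of the fibres of `f`. -/
def fiberInd (K : Type*) [Field K] (f : ι → σ) : Matrix ι σ K :=
  of fun i s => if f i = s then 1 else 0

theorem sum_fiberCard (f : ι → σ) : ∑ s, fiberCard f s = Fintype.card ι :=
  (Finset.card_eq_sum_card_fiberwise fun i _ => Finset.mem_univ (f i)).symm

theorem fiberInd_mul_diagonal_mul (f : ι → σ) :
    fiberInd K f * diagonal (fun s => (fiberCard f s : K)⁻¹) * (fiberInd K f)ᵀ =
      fiberAvg K f := by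
  ext i j
  rw [mul_apply, Finset.sum_eq_single (f i)]
  · simp [fiberInd, fiberAvg, mul_diagonal, eq_comm]
  · intro s _ hs
    simp [fiberInd, mul_diagonal, Ne.symm hs]
  · simp

theorem fiberAvg_mulVec_one (f : ι → σ) : fiberAvg K f *ᵥ 1 = 1 := by
  ext i
  have h : ∀ j, fiberAvg K f i j = (if f j = f i then 1 else 0) * (fiberCard f (f i) : K)⁻¹ := by
    intro j
    simp [fiberAvg, eq_comm]
  simp only [mulVec, dotProduct, h, Pi.one_apply, mul_one, ← Finset.sum_mul, Finset.sum_boole]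
  exact mul_inv_cancel₀ (fiberCard_apply_ne_zero f i)

theorem one_vecMul_fiberAvg (f : ι → σ) : 1 ᵥ* fiberAvg K f = 1 := by
  have h : (fiberAvg K f)ᵀ = fiberAvg K f := by
    ext i j
    simp only [fiberAvg, transpose_apply, of_apply]
    by_cases h : f i = f j
    · simp [h]
    · simp [h, Ne.symm h]
  rw [← mulVec_transpose, h, fiberAvg_mulVec_one]

theorem fiberAvg_mul_allOnes (f : ι → σ) : fiberAvg K f * allOnes ι K = allOnes ι K := by
  rw [allOnes, mul_vecMulVec, fiberAvg_mulVec_one]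

theorem allOnes_mul_fiberAvg (f : ι → σ) : allOnes ι K * fiberAvg K f = allOnes ι K := by
  rw [allOnes, vecMulVec_mul, one_vecMul_fiberAvg]

/-- Take the vertex degrees, that is the fibre sizes, as test vectors: each sums to the number of
edges, and the correction is `Fᵀ J G`. Eliminating the `τ` block by a Schur complement and using
det(1 - XY) = det(1 - YX) moves from `σ` to `ι`, where `F D⁻¹ Fᵀ` and `G E⁻¹ Gᵀ` are the averaging
matrices. Surjectivity of the colourings makes `D` and `E` invertible. -/
theorem treeSum_mul_card_sq (s₀ : σ) {f : ι → σ} {g : ι → τ} (hf : ∀ s, fiberCard f s ≠ 0)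
    (hg : ∀ t, fiberCard g t ≠ 0) :
    treeSum s₀ (fun _ => (1 : K)) (fun i => (f i, g i)) * (Fintype.card ι : K) ^ 2 =
      (∏ s, (fiberCard f s : K)) * (∏ t, (fiberCard g t : K)) *
        (1 - fiberAvg K f * fiberAvg K g + allOnes ι K).det := by
  have h1 := treeSum_mul_eq_det_sub_vecMulVec s₀ (fun _ : ι => (1 : K)) (fun i => (f i, g i))
    (fun s => (fiberCard f s : K)) (fun t => (fiberCard g t : K))
  rw [← Nat.cast_sum, ← Nat.cast_sum, sum_fiberCard, sum_fiberCard, ← sq] at h1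
  rw [h1, sum_vecMulVec_edgeVec_eq_fromBlocks]
  set F := fiberInd K f with hF
  set G := fiberInd K g with hG
  set J := allOnes ι K with hJ
  have h2 : (vecMulVec (Sum.elim (fun s => (fiberCard f s : K)) 0)
      (Sum.elim 0 (fun t => (fiberCard g t : K))) : Matrix (σ ⊕ τ) (σ ⊕ τ) K) =
      fromBlocks 0 (Fᵀ * J * G) 0 0 := by
    have h3 : Fᵀ * J * G = vecMulVec (fun s => (fiberCard f s : K))
        (fun t => (fiberCard g t : K)) := by
      rw [hJ, allOnes, mul_vecMulVec, vecMulVec_mul]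
      congr 1
      · ext s
        simp [hF, fiberInd, mulVec, dotProduct, fiberCard]
      · ext t
        simp [hG, fiberInd, vecMul, dotProduct, fiberCard]
    rw [h3]
    ext a b
    rcases a with a | a <;> rcases b with b | b <;> simp [vecMulVec_apply]
  have h4 : (of fun s t => ∑ i, if f i = s ∧ g i = t then (1 : K) else 0) = Fᵀ * G := by
    ext s t
    rw [mul_apply]
    refine Finset.sum_congr rfl fun i _ => ?_
    simp only [hF, hG, fiberInd, transpose_apply, of_apply]
    grind
  have h5 : (of fun t s => ∑ i, if f i = s ∧ g i = t then (1 : K) else 0) = Gᵀ * F := by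
    ext s t
    rw [mul_apply]
    refine Finset.sum_congr rfl fun i _ => ?_
    simp only [hF, hG, fiberInd, transpose_apply, of_apply]
    grind
  have h6 : ∀ s, (∑ i, if f i = s then (1 : K) else 0) = fiberCard f s := by
    intro s
    rw [Finset.sum_boole, fiberCard]
  have h7 : ∀ t, (∑ i, if g i = t then (1 : K) else 0) = fiberCard g t := by
    intro t
    rw [Finset.sum_boole, fiberCard]
  simp only [h4, h5, h6, h7]
  set D := diagonal (fun s => (fiberCard f s : K)) with hD
  set E := diagonal (fun t => (fiberCard g t : K)) with hE
  set D' := diagonal (fun s => (fiberCard f s : K)⁻¹) with hD'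
  set E' := diagonal (fun t => (fiberCard g t : K)⁻¹) with hE'
  have hDD : D * D' = 1 := by
    rw [hD, hD', diagonal_mul_diagonal, ← diagonal_one]
    congr 1
    ext s
    exact mul_inv_cancel₀ (Nat.cast_ne_zero.2 (hf s))
  have hEE : E * E' = 1 := by
    rw [hE, hE', diagonal_mul_diagonal, ← diagonal_one]
    congr 1
    ext s
    exact mul_inv_cancel₀ (Nat.cast_ne_zero.2 (hg s))
  let _ : Invertible E := invertibleOfRightInverse E E' hEE
  have hE2 : ⅟E = E' := rfl
  rw [h2, sub_eq_add_neg, fromBlocks_neg, fromBlocks_add, neg_zero, neg_zero, neg_zero, add_zero,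
    add_zero, add_zero, det_fromBlocks₂₂, hE2]
  have h8 : D - (Fᵀ * G + -(Fᵀ * J * G)) * E' * (Gᵀ * F) =
      D * (1 - (D' * Fᵀ * (1 - J) * (G * E' * Gᵀ)) * F) := by
    have : D * (D' * Fᵀ * (1 - J) * (G * E' * Gᵀ) * F) =
        (D * D') * (Fᵀ * (1 - J) * (G * E' * Gᵀ) * F) := by
      simp only [Matrix.mul_assoc]
    rw [Matrix.mul_sub, Matrix.mul_one, this, hDD, Matrix.one_mul]
    simp only [Matrix.mul_assoc, Matrix.add_mul, Matrix.neg_mul, Matrix.mul_add, Matrix.mul_neg,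
      Matrix.one_mul, sub_eq_add_neg]
  rw [h8, det_mul, det_one_sub_mul_comm]
  have h9 : F * (D' * Fᵀ * (1 - J) * (G * E' * Gᵀ)) =
      (F * D' * Fᵀ) * (1 - J) * (G * E' * Gᵀ) := by
    simp only [Matrix.mul_assoc]
  rw [h9, fiberInd_mul_diagonal_mul, fiberInd_mul_diagonal_mul, Matrix.mul_sub, Matrix.mul_one,
    Matrix.sub_mul, fiberAvg_mul_allOnes, allOnes_mul_fiberAvg, hD, hE, det_diagonal,
    det_diagonal, sub_sub_eq_add_sub, ← sub_add_eq_add_sub]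
  ring

end Schur

/-! ### Detecting long cycles by a determinant -/

section LongCycle

variable {ι K : Type*} [Fintype ι] [DecidableEq ι] [Field K] [CharZero K]

theorem one_sub_permMat_mulVec {R : Type*} [CommRing R] (g : Equiv.Perm ι) {k : ι → R}
    (hk : ∀ i, k (g i) = k i) : (1 - permMat R g) *ᵥ k = 0 := by
  rw [sub_mulVec, one_mulVec, sub_eq_zero]
  ext i
  have h : ∀ j, i = g j ↔ g.symm i = j := fun j => Equiv.symm_apply_eq g |>.symm
  have h2 := hk (g.symm i)
  rw [Equiv.apply_symm_apply] at h2
  simp [permMat, mulVec, dotProduct, h, h2]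

theorem one_vecMul_one_sub_permMat {R : Type*} [CommRing R] (g : Equiv.Perm ι) :
    (1 : ι → R) ᵥ* (1 - permMat R g) = 0 := by
  rw [vecMul_sub, vecMul_one, sub_eq_zero]
  ext j
  simp [permMat, vecMul, dotProduct]

/-- The indicator of the cycle of `i`, scaled and shifted to have sum zero, is killed both by `1 -
P` and by the all-ones matrix; it is nonzero at `j`. -/
theorem det_one_sub_permMat_add_allOnes_eq_zero (g : Equiv.Perm ι) {i j : ι}
    (h : ¬ g.SameCycle i j) : (1 - permMat K g + allOnes ι K).det = 0 := by
  classical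
  set S := Finset.univ.filter fun x => g.SameCycle i x with hS
  set k : ι → K := fun x => Fintype.card ι * (if g.SameCycle i x then 1 else 0) - S.card with hk
  refine exists_mulVec_eq_zero_iff.1 ⟨k, fun h0 => ?_, ?_⟩
  · have h1 := congrFun h0 j
    simp only [hk, h, if_false, mul_zero, zero_sub, Pi.zero_apply, neg_eq_zero,
      Nat.cast_eq_zero, Finset.card_eq_zero] at h1
    have h2 : i ∈ S := by simp [hS, Equiv.Perm.SameCycle.refl]
    simp [h1] at h2
  · rw [add_mulVec, one_sub_permMat_mulVec g, allOnes, vecMulVec_mulVec, zero_add]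
    · have : (1 : ι → K) ⬝ᵥ k = 0 := by
        simp only [dotProduct, Pi.one_apply, one_mul, hk, Finset.sum_sub_distrib,
          ← Finset.mul_sum, Finset.sum_boole, Finset.sum_const, Finset.card_univ, nsmul_eq_mul]
        exact sub_self _
      rw [this]
      simp
    · intro x
      simp [hk]

/-- The added corner entry cancels the wrap-around entry of the rotation, leaving a lower
unitriangular matrix. -/
theorem det_one_sub_permMat_finRotate_add (m : ℕ) (R : Type*) [CommRing R] :
    (1 - permMat R (finRotate (m + 1)) +
      vecMulVec (Pi.single 0 1) (Pi.single (Fin.last m) 1)).det = 1 := by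
  rw [det_of_isLowerTriangular]
  · refine Finset.prod_eq_one fun i _ => ?_
    rcases Fin.eq_castSucc_or_eq_last i with ⟨j, rfl⟩ | rfl
    · have h : j.castSucc ≠ Fin.last m := j.castSucc_lt_last.ne
      have h2 : j.castSucc ≠ j.succ := j.castSucc_lt_succ.ne
      simpa [permMat, vecMulVec_apply, h] using fun h3 => absurd h3 h2
    · simp [permMat, vecMulVec_apply, Pi.single_apply]
  · intro i j hij
    have hij : i < j := hij
    rcases Fin.eq_castSucc_or_eq_last j with ⟨j, rfl⟩ | rfl
    · have h : j.castSucc ≠ Fin.last m := j.castSucc_lt_last.ne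
      have h2 : i ≠ j.succ := (hij.trans j.castSucc_lt_succ).ne
      simp [permMat, vecMulVec_apply, h, hij.ne, h2]
    · simp [permMat, vecMulVec_apply, Pi.single_apply, hij.ne]

/-- The constant vector is a left and right null vector of `1 - P`, so the adjugate form on `(1, 1)`
is `(m + 1)²` times the one on two basis vectors, which the corner computation shows to be 1. -/
theorem det_one_sub_permMat_finRotate_add_allOnes (m : ℕ) :
    (1 - permMat K (finRotate (m + 1)) + allOnes (Fin (m + 1)) K).det = ((m + 1 : ℕ) : K) ^ 2 := by
  have h0 := one_sub_permMat_mulVec (R := K) (finRotate (m + 1)) (k := 1) (fun _ => rfl)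
  have hk : (1 : Fin (m + 1) → K) ≠ 0 := one_ne_zero
  have hd : (1 - permMat K (finRotate (m + 1))).det = 0 :=
    exists_mulVec_eq_zero_iff.1 ⟨1, hk, h0⟩
  have h := dotProduct_adjugate_mul_eq hk h0 (one_vecMul_one_sub_permMat _) 1 1
    (Pi.single 0 1) (Pi.single (Fin.last m) 1)
  have h1 := det_one_sub_permMat_finRotate_add m K
  rw [det_add_vecMulVec, hd, zero_add] at h1
  rw [allOnes, det_add_vecMulVec, hd, zero_add]
  rw [h1] at h
  simpa [sq] using h

theorem det_one_sub_permMat_conj (k g : Equiv.Perm ι) :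
    (1 - permMat K (k * g * k⁻¹) + allOnes ι K).det =
      (1 - permMat K g + allOnes ι K).det := by
  have h1 : permMat K k * permMat K k⁻¹ = 1 := by
    rw [← permMat_mul, mul_inv_cancel]
    ext i j
    simp only [permMat, of_apply, one_apply]
    rfl
  have h2 : ∀ k : Equiv.Perm ι, permMat K k *ᵥ 1 = 1 := fun k => by
    have := one_sub_permMat_mulVec (R := K) k (k := 1) (fun _ => rfl)
    rw [sub_mulVec, one_mulVec, sub_eq_zero] at this
    exact this.symm
  have h3 : ∀ k : Equiv.Perm ι, 1 ᵥ* permMat K k = 1 := fun k => by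
    have := one_vecMul_one_sub_permMat (R := K) k
    rw [vecMul_sub, vecMul_one, sub_eq_zero] at this
    exact this.symm
  have h4 : 1 - permMat K (k * g * k⁻¹) + allOnes ι K =
      permMat K k * (1 - permMat K g + allOnes ι K) * permMat K k⁻¹ := by
    rw [Matrix.mul_add, Matrix.add_mul, Matrix.mul_sub, Matrix.sub_mul, Matrix.mul_one, h1,
      permMat_mul, permMat_mul, allOnes, mul_vecMulVec, vecMulVec_mul, h2, h3]
  rw [h4, det_mul_right_comm, h1, Matrix.one_mul]

end LongCycle

end Matrix

theorem permType_eq_indiscrete_of_sameCycle {n : ℕ} (hn : 1 ≤ n) {g : Equiv.Perm (Fin n)}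
    (h : ∀ i j, g.SameCycle i j) : permType g = Nat.Partition.indiscrete n := by
  -- For `n = 1` the only point is fixed, so the permutation is not a cycle in the sense of
  -- `IsCycle`.
  rcases hn.eq_or_lt with rfl | hn
  · exact Subsingleton.elim _ _
  have hmove : ∀ i, g i ≠ i := by
    intro i hi
    have : Nontrivial (Fin n) := Fin.nontrivial_iff_two_le.2 hn
    obtain ⟨j, hj⟩ := exists_ne i
    exact hj ((h i j).eq_of_left hi).symm
  have hcyc : g.IsCycle := ⟨⟨0, by omega⟩, hmove _, fun y _ => h _ y⟩
  have hsupp : g.support = Finset.univ := by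
    ext i
    simp [hmove i]
  rw [Nat.Partition.ext_iff, Nat.Partition.indiscrete_parts (by omega)]
  change g.partition.parts = {n}
  rw [Equiv.Perm.parts_partition, hcyc.cycleType, hsupp]
  simp

theorem permType_finRotate (m : ℕ) :
    permType (finRotate (m + 1)) = Nat.Partition.indiscrete (m + 1) := by
  refine permType_eq_indiscrete_of_sameCycle (by omega) fun i j => ?_
  rcases m with _ | m
  · rw [Fin.fin_one_eq_zero i, Fin.fin_one_eq_zero j]
  · exact (isCycle_finRotate.isCycleOn).2 (by simp) (by simp)

open Matrix in
/-- Detecting long cycles by a determinant. -/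
theorem det_one_sub_permMat_add_allOnes {n : ℕ} (hn : 1 ≤ n) (g : Equiv.Perm (Fin n)) :
    (1 - permMat ℂ g + allOnes (Fin n) ℂ).det =
      if permType g = Nat.Partition.indiscrete n then (n : ℂ) ^ 2 else 0 := by
  split_ifs with h
  · obtain ⟨m, rfl⟩ : ∃ m, n = m + 1 := ⟨n - 1, by omega⟩
    rw [← permType_finRotate, permType_eq_iff, isConj_comm, isConj_iff] at h
    obtain ⟨k, rfl⟩ := h
    rw [det_one_sub_permMat_conj, det_one_sub_permMat_finRotate_add_allOnes]
  · have : ¬ ∀ i j, g.SameCycle i j := fun h' => h (permType_eq_indiscrete_of_sameCycle hn h')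
    push Not at this
    obtain ⟨i, j, hij⟩ := this
    exact det_one_sub_permMat_add_allOnes_eq_zero g hij

/-! ### Coefficients of the generating polynomials -/

section ColoredFactorizations

open Matrix

namespace MvPolynomial

variable {σ τ R : Type*} [CommSemiring R]

theorem coeff_rename_inl_mul_rename_inr (A : σ →₀ ℕ) (B : τ →₀ ℕ) (p : MvPolynomial σ R)
    (q : MvPolynomial τ R) :
    (rename Sum.inl p * rename Sum.inr q : MvPolynomial (σ ⊕ τ) R).coeff (A.sumElim B) =
      p.coeff A * q.coeff B := by
  classical
  induction p using MvPolynomial.induction_on' with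
  | add p p' hp hp' => rw [map_add, add_mul, coeff_add, hp, hp', coeff_add, add_mul]
  | monomial a r =>
    induction q using MvPolynomial.induction_on' with
    | add q q' hq hq' => rw [map_add, mul_add, coeff_add, hq, hq', coeff_add, mul_add]
    | monomial b r' =>
      rw [rename_monomial, rename_monomial, monomial_mul, coeff_monomial, coeff_monomial,
        coeff_monomial]
      have h : a.mapDomain Sum.inl + b.mapDomain Sum.inr = a.sumElim b := by
        ext (s | t)
        · simp [Finsupp.mapDomain_apply Sum.inl_injective, Finsupp.mapDomain_of_notMem_range]
        · simp [Finsupp.mapDomain_apply Sum.inr_injective, Finsupp.mapDomain_of_notMem_range]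
      have h2 : a.sumElim b = A.sumElim B ↔ a = A ∧ b = B := by
        constructor
        · intro h
          constructor
          · ext s
            simpa using DFunLike.congr_fun h (Sum.inl s)
          · ext t
            simpa using DFunLike.congr_fun h (Sum.inr t)
        · rintro ⟨rfl, rfl⟩
          rfl
      rw [h, if_congr h2 rfl rfl]
      by_cases ha : a = A <;> by_cases hb : b = B <;> simp [ha, hb]

variable [Fintype σ]

theorem prod_X_pow_eq_monomial_equivFunOnFinite (a : σ → ℕ) :
    ∏ s, (X s : MvPolynomial σ R) ^ a s = monomial (Finsupp.equivFunOnFinite.symm a) 1 := by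
  rw [monomial_eq, C_1, one_mul, Finsupp.prod_fintype _ _ (by simp)]
  simp

theorem coeff_univ_prod_X_pow [DecidableEq σ] (a : σ → ℕ) (A : σ →₀ ℕ) :
    (∏ s, (X s : MvPolynomial σ R) ^ a s).coeff A = if a = A then 1 else 0 := by
  rw [prod_X_pow_eq_monomial_equivFunOnFinite, coeff_monomial]
  refine if_congr ?_ rfl rfl
  rw [Equiv.symm_apply_eq]
  rfl

theorem coeff_prod_X [DecidableEq σ] {ι : Type*} [Fintype ι] (f : ι → σ) (A : σ →₀ ℕ) :
    (∏ i, (X (f i) : MvPolynomial σ R)).coeff A = if fiberCard f = A then 1 else 0 := by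
  rw [← coeff_univ_prod_X_pow, ← Finset.prod_fiberwise Finset.univ f]
  congr 1
  refine Finset.prod_congr rfl fun s _ => ?_
  rw [fiberCard, ← Finset.prod_const]
  exact Finset.prod_congr rfl fun i hi => by rw [(Finset.mem_filter.1 hi).2]

theorem coeff_prod_X_equivFunOnFinite [DecidableEq σ] {ι : Type*} [Fintype ι] (f : ι → σ)
    (A : σ → ℕ) :
    (∏ i, (X (f i) : MvPolynomial σ R)).coeff (Finsupp.equivFunOnFinite.symm A) =
      if fiberCard f = A then 1 else 0 :=
  coeff_prod_X f _

/-- Only the exponent `A - 1` of the multinomial expansion contributes; its multinomial coefficient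
is stated with denominators cleared. -/
theorem coeff_sum_X_pow_mul_prod_X [DecidableEq σ] (N : ℕ) (A : σ →₀ ℕ) (hA : ∀ s, A s ≠ 0)
    (hN : ∑ s, A s = N + Fintype.card σ) :
    (((∑ s, X s) ^ N * ∏ s, X s : MvPolynomial σ R)).coeff A * ∏ s, ((A s - 1)! : R) = N ! := by
  have hsum : ∑ s, (A s - 1) = N := by
    have h : ∑ s, A s = ∑ s, (A s - 1) + Fintype.card σ := by
      rw [← Finset.card_univ, Finset.card_eq_sum_ones, ← Finset.sum_add_distrib]
      exact Finset.sum_congr rfl fun s _ => by have := hA s; omega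
    omega
  rw [Finset.sum_pow_eq_sum_piAntidiag, Finset.sum_mul, coeff_sum,
    Finset.sum_eq_single (fun s => A s - 1)]
  · rw [mul_assoc, ← Finset.prod_mul_distrib]
    simp only [← pow_succ]
    rw [← C_eq_coe_nat, coeff_C_mul, coeff_univ_prod_X_pow, if_pos]
    · rw [mul_one, mul_comm, ← Nat.cast_prod, ← Nat.cast_mul, Nat.multinomial_spec, hsum]
    · ext s
      have := hA s
      change A s - 1 + 1 = A s
      omega
  · intro k _ hk
    rw [mul_assoc, ← Finset.prod_mul_distrib]
    simp only [← pow_succ]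
    rw [← C_eq_coe_nat, coeff_C_mul, coeff_univ_prod_X_pow, if_neg, mul_zero]
    intro h
    refine hk ?_
    funext s
    have : k s + 1 = A s := congrFun h s
    omega
  · intro h
    refine absurd ?_ h
    simp [hsum]

end MvPolynomial

/-! ### Counting coloured factorizations of long cycles -/

section Core

variable {σ τ : Type*} [Fintype σ] [DecidableEq σ] [Fintype τ] [DecidableEq τ]

theorem card_fiberPerms {ι : Type*} [Fintype ι] [DecidableEq ι] (f : ι → σ) :
    (fiberPerms f).card = ∏ s, (fiberCard f s)! := by
  have h := DomMulAct.stabilizer_card f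
  rw [Fintype.card_subtype] at h
  have h1 : (fiberPerms f) = Finset.univ.filter fun g : Equiv.Perm ι => f ∘ g = f := by
    ext g
    simp [mem_fiberPerms, funext_iff]
  rw [h1, h]
  refine Finset.prod_congr rfl fun s _ => ?_
  rw [fiberCard, Fintype.card_subtype]

/-- Permutation and averaging matrices fix the all-ones matrix `J` on both sides, so `1 - AB + J` is
`1 - A(B - J)` or `1 - (A - J)B`. This is the shape needed for averaging, done once for each factor;
det(1 - XY) = det(1 - YX) brings the factor being averaged to the left. -/
theorem det_one_sub_permMat_mul_add_allOnes_sum {n : ℕ} (f : Fin n → σ) (g : Fin n → τ) :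
    ∑ a ∈ fiberPerms f, ∑ b ∈ fiberPerms g, (1 - permMat ℂ (a * b) + allOnes (Fin n) ℂ).det =
      (fiberPerms f).card * (fiberPerms g).card *
        (1 - fiberAvg ℂ f * fiberAvg ℂ g + allOnes (Fin n) ℂ).det := by
  have hP : ∀ a : Equiv.Perm (Fin n), permMat ℂ a * allOnes (Fin n) ℂ = allOnes (Fin n) ℂ := by
    intro a
    have := one_sub_permMat_mulVec (R := ℂ) a (k := 1) (fun _ => rfl)
    rw [sub_mulVec, one_mulVec, sub_eq_zero] at this
    rw [allOnes, mul_vecMulVec, ← this]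
  have h1 : ∀ (A B : Matrix (Fin n) (Fin n) ℂ), A * allOnes (Fin n) ℂ = allOnes (Fin n) ℂ →
      1 - A * B + allOnes (Fin n) ℂ = 1 - A * (B - allOnes (Fin n) ℂ) := by
    intro A B h
    rw [Matrix.mul_sub, h]
    abel
  have h2 : ∀ (A B : Matrix (Fin n) (Fin n) ℂ), allOnes (Fin n) ℂ * B = allOnes (Fin n) ℂ →
      1 - A * B + allOnes (Fin n) ℂ = 1 - (A - allOnes (Fin n) ℂ) * B := by
    intro A B h
    rw [Matrix.sub_mul, h]
    abel
  have h3 : ∀ a : Equiv.Perm (Fin n),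
      ∑ b ∈ fiberPerms g, (1 - permMat ℂ (a * b) + allOnes (Fin n) ℂ).det =
        (fiberPerms g).card *
          (1 - permMat ℂ a * (fiberAvg ℂ g - allOnes (Fin n) ℂ)).det := by
    intro a
    have h4 : ∀ b, (1 - permMat ℂ (a * b) + allOnes (Fin n) ℂ).det =
        (1 - permMat ℂ b * (permMat ℂ a - allOnes (Fin n) ℂ)).det := by
      intro b
      have hb : allOnes (Fin n) ℂ * permMat ℂ b = allOnes (Fin n) ℂ := by
        have := one_vecMul_one_sub_permMat (R := ℂ) b
        rw [vecMul_sub, vecMul_one, sub_eq_zero] at this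
        rw [allOnes, vecMulVec_mul, ← this]
      rw [permMat_mul, h2 _ _ hb, det_one_sub_mul_comm]
    simp only [h4]
    rw [sum_det_sub_permMat_mul, det_one_sub_mul_comm, ← h2 _ _ (allOnes_mul_fiberAvg g),
      h1 _ _ (hP a)]
  simp only [h3]
  rw [← Finset.mul_sum, sum_det_sub_permMat_mul, ← h1 _ _ (fiberAvg_mul_allOnes f)]
  ring

/-- The functions on `Fin n` with prescribed fibre sizes. -/
def contentFuns (n : ℕ) (A : σ → ℕ) : Finset (Fin n → σ) :=
  Finset.univ.filter fun f => fiberCard f = A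

theorem mem_contentFuns {n : ℕ} {A : σ → ℕ} {f : Fin n → σ} :
    f ∈ contentFuns n A ↔ fiberCard f = A := by
  simp [contentFuns]

theorem map_treeSum {R S κ : Type*} [CommRing R] [CommRing S] [Fintype κ] (ψ : R →+* S) (s₀ : σ)
    (e : κ → σ × τ) :
    ψ (treeSum s₀ (fun _ => 1) e) = treeSum s₀ (fun _ => 1) e := by
  simp only [treeSum, single_one_dotProduct, mulVec_single_one, col_apply]
  have h : (∑ i, (1 : S) • vecMulVec (edgeVec S (e i)) (edgeVec S (e i))) =
      ψ.mapMatrix (∑ i, (1 : R) • vecMulVec (edgeVec R (e i)) (edgeVec R (e i))) := by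
    have h1 : ∀ a (b : σ ⊕ τ), ψ (edgeVec R a b) = edgeVec S a b := by
      rintro a (b | b) <;> simp only [edgeVec, Sum.elim_inl, Sum.elim_inr, Pi.single_apply] <;>
        split_ifs <;> simp
    rw [map_sum]
    refine Finset.sum_congr rfl fun i _ => ?_
    ext a b
    simp [vecMulVec_apply, h1]
  rw [h, ← RingHom.map_adjugate]
  rfl

open MvPolynomial in
-- An n-tuple of edges is a pair of colourings. The sum over tuples of edges, with weights `x_s
-- y_t`, reduces to the complete bipartite graph, whose cofactor is known.
theorem sum_prod_X_mul_treeSum (n : ℕ) (s₀ : σ) (t₀ : τ) :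
    ∑ h : Fin n → σ × τ, (∏ i, (X (Sum.inl (h i).1) * X (Sum.inr (h i).2) :
        MvPolynomial (σ ⊕ τ) ℂ)) * C (treeSum s₀ (fun _ => 1) h) =
      C (n.descFactorial (Fintype.card σ + Fintype.card τ - 1) : ℂ) *
        (rename Sum.inl ((∑ s, X s) ^ (n - Fintype.card σ) * ∏ s, X s) *
          rename Sum.inr ((∑ t, X t) ^ (n - Fintype.card τ) * ∏ t, X t)) := by
  have hσ : 0 < Fintype.card σ := Fintype.card_pos_iff.2 ⟨s₀⟩
  have hτ : 0 < Fintype.card τ := Fintype.card_pos_iff.2 ⟨t₀⟩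
  have : Nonempty σ := ⟨s₀⟩
  set x : σ → MvPolynomial (σ ⊕ τ) ℂ := fun s => X (Sum.inl s) with hx
  set y : τ → MvPolynomial (σ ⊕ τ) ℂ := fun t => X (Sum.inr t) with hy
  have h1 := sum_prod_mul_dotProduct_adjugate (fun a : σ × τ => x a.1 * y a.2)
    (fun a => edgeVec (MvPolynomial (σ ⊕ τ) ℂ) a) (Pi.single (Sum.inl s₀) 1) n
    (det_sum_vecMulVec_edgeVec _ id) (fun h => by
      have := det_sum_vecMulVec_edgeVec (fun _ => (1 : MvPolynomial (σ ⊕ τ) ℂ)) h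
      simpa only [one_smul] using this)
  have h2 := treeSum_complete s₀ x y
  have h3 : ∀ h : Fin n → σ × τ, (C (treeSum s₀ (fun _ => 1) h) : MvPolynomial (σ ⊕ τ) ℂ) =
      Pi.single (Sum.inl s₀) 1 ⬝ᵥ
        ((∑ i, vecMulVec (edgeVec _ (h i)) (edgeVec _ (h i))).adjugate *ᵥ
          Pi.single (Sum.inl s₀) 1) := by
    intro h
    rw [map_treeSum, treeSum]
    simp only [one_smul]
  have hX : (∑ s, x s) ≠ 0 := by
    intro h
    have := congrArg (MvPolynomial.eval (fun _ => (1 : ℂ))) h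
    simp [hx, hσ.ne'] at this
  have hY : (∑ t, y t) ≠ 0 := by
    intro h
    have := congrArg (MvPolynomial.eval (fun _ => (1 : ℂ))) h
    simp [hy, hτ.ne'] at this
  have h4 : treeSum s₀ (fun a : σ × τ => x a.1 * y a.2) id =
      (∏ s, x s) * (∏ t, y t) * (∑ t, y t) ^ (Fintype.card σ - 1) *
        (∑ s, x s) ^ (Fintype.card τ - 1) := by
    refine mul_right_cancel₀ (mul_ne_zero hX hY) ?_
    rw [h2]
    obtain ⟨a, ha⟩ : ∃ a, Fintype.card σ = a + 1 := ⟨_, (Nat.succ_pred_eq_of_pos hσ).symm⟩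
    obtain ⟨b, hb⟩ : ∃ b, Fintype.card τ = b + 1 := ⟨_, (Nat.succ_pred_eq_of_pos hτ).symm⟩
    rw [ha, hb, Nat.add_sub_cancel, Nat.add_sub_cancel]
    ring
  have h5 : ∑ a : σ × τ, x a.1 * y a.2 = (∑ s, x s) * ∑ t, y t := by
    rw [Fintype.sum_prod_type, Finset.sum_mul_sum]
  simp only [h3]
  refine h1.trans ?_
  change _ * _ * treeSum s₀ (fun a : σ × τ => x a.1 * y a.2) id = _
  rw [h4, h5, Fintype.card_sum]
  simp only [map_mul, map_pow, map_sum, map_prod, rename_X, map_natCast]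
  change _ = _ * ((∑ s, x s) ^ _ * (∏ s, x s) * ((∑ t, y t) ^ _ * (∏ t, y t)))
  -- Natural subtraction truncates here, but the falling factorial is then zero; otherwise the
  -- powers of the total weight and of the complete-graph cofactor combine.
  by_cases hm : n < Fintype.card σ + Fintype.card τ - 1
  · rw [Nat.descFactorial_eq_zero_iff_lt.2 hm]
    simp
  · have e1 : n - Fintype.card σ =
        n - (Fintype.card σ + Fintype.card τ - 1) + (Fintype.card τ - 1) := by omega
    have e2 : n - Fintype.card τ =
        n - (Fintype.card σ + Fintype.card τ - 1) + (Fintype.card σ - 1) := by omega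
    rw [e1, e2]
    ring

theorem card_le_sum_of_ne_zero {κ : Type*} [Fintype κ] (D : κ → ℕ) (hD : ∀ s, D s ≠ 0) :
    Fintype.card κ ≤ ∑ s, D s := by
  rw [← Finset.card_univ, Finset.card_eq_sum_ones]
  exact Finset.sum_le_sum fun s _ => Nat.one_le_iff_ne_zero.2 (hD s)

theorem cast_prod_factorial {κ : Type*} [Fintype κ] (D : κ → ℕ) (hD : ∀ s, D s ≠ 0) :
    ((∏ s, (D s)! : ℕ) : ℂ) = (∏ s, (D s : ℂ)) * ∏ s, ((D s - 1)! : ℂ) := by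
  rw [Nat.cast_prod, ← Finset.prod_mul_distrib]
  refine Finset.prod_congr rfl fun s _ => ?_
  rw [← Nat.cast_mul, Nat.mul_factorial_pred (hD s)]

open MvPolynomial in
theorem sum_contentFuns_treeSum (n : ℕ) (s₀ : σ) (t₀ : τ) (A : σ → ℕ) (B : τ → ℕ)
    (hA : ∀ s, A s ≠ 0) (hB : ∀ t, B t ≠ 0) (hAn : ∑ s, A s = n) (hBn : ∑ t, B t = n) :
    (∑ f ∈ contentFuns n A, ∑ g ∈ contentFuns n B,
        treeSum s₀ (fun _ => (1 : ℂ)) fun i => (f i, g i)) *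
        ((∏ s, ((A s - 1)! : ℂ)) * ∏ t, ((B t - 1)! : ℂ)) =
      n.descFactorial (Fintype.card σ + Fintype.card τ - 1) *
        ((n - Fintype.card σ)! * (n - Fintype.card τ)!) := by
  have h := congrArg (coeff ((Finsupp.equivFunOnFinite.symm A).sumElim
    (Finsupp.equivFunOnFinite.symm B))) (sum_prod_X_mul_treeSum n s₀ t₀)
  rw [coeff_C_mul, coeff_rename_inl_mul_rename_inr, coeff_sum] at h
  have h1 : ∀ e : Fin n → σ × τ, ((∏ i, (X (Sum.inl (e i).1) * X (Sum.inr (e i).2) :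
        MvPolynomial (σ ⊕ τ) ℂ)) * C (treeSum s₀ (fun _ => 1) e)).coeff
        ((Finsupp.equivFunOnFinite.symm A).sumElim (Finsupp.equivFunOnFinite.symm B)) =
      if fiberCard (fun i => (e i).1) = A then
        if fiberCard (fun i => (e i).2) = B then treeSum s₀ (fun _ => (1 : ℂ)) e else 0
      else 0 := by
    intro e
    have h2 : (∏ i, (X (Sum.inl (e i).1) * X (Sum.inr (e i).2) : MvPolynomial (σ ⊕ τ) ℂ)) =
        rename Sum.inl (∏ i, X (e i).1) * rename Sum.inr (∏ i, X (e i).2) := by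
      simp [Finset.prod_mul_distrib]
    rw [h2, mul_comm, coeff_C_mul, coeff_rename_inl_mul_rename_inr, coeff_prod_X_equivFunOnFinite,
      coeff_prod_X_equivFunOnFinite]
    split_ifs <;> simp
  have hσ := coeff_sum_X_pow_mul_prod_X (R := ℂ) (n - Fintype.card σ)
    (Finsupp.equivFunOnFinite.symm A) hA (by
      have := card_le_sum_of_ne_zero A hA
      simp only [Finsupp.coe_equivFunOnFinite_symm]
      omega)
  have hτ := coeff_sum_X_pow_mul_prod_X (R := ℂ) (n - Fintype.card τ)
    (Finsupp.equivFunOnFinite.symm B) hB (by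
      have := card_le_sum_of_ne_zero B hB
      simp only [Finsupp.coe_equivFunOnFinite_symm]
      omega)
  simp only [Finsupp.coe_equivFunOnFinite_symm] at hσ hτ
  simp only [h1] at h
  have h3 : (∑ f ∈ contentFuns n A, ∑ g ∈ contentFuns n B,
      treeSum s₀ (fun _ => (1 : ℂ)) fun i => (f i, g i)) =
      ∑ e : Fin n → σ × τ, if fiberCard (fun i => (e i).1) = A then
        if fiberCard (fun i => (e i).2) = B then treeSum s₀ (fun _ => (1 : ℂ)) e else 0
      else 0 := by
    rw [← (Equiv.arrowProdEquivProdArrow (Fin n) (fun _ => σ) (fun _ => τ)).symm.sum_comp,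
      Fintype.sum_prod_type]
    simp only [contentFuns, Finset.sum_filter]
    refine Finset.sum_congr rfl fun f _ => ?_
    split_ifs with hf
    · refine Finset.sum_congr rfl fun g _ => ?_
      simp only [Equiv.arrowProdEquivProdArrow, Equiv.coe_fn_symm_mk, hf, if_true]
      rfl
    · simp [Equiv.arrowProdEquivProdArrow, hf]
  rw [h3, h, ← hσ, ← hτ]
  ring

/-- For each pair of colourings, comparing the two evaluations of the averaged determinant gives:
number of pairs = number of trees times `∏ (A s - 1)! ∏ (B t - 1)!`, because `a! = a (a - 1)!`
absorbs the fibre sizes. These factorials are also the denominators of the tree sum. -/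
theorem sum_contentFuns_card_longCycle_of_pos {n : ℕ} (hn : 1 ≤ n) (A : σ → ℕ) (B : τ → ℕ)
    (hA : ∀ s, A s ≠ 0) (hB : ∀ t, B t ≠ 0) (hAn : ∑ s, A s = n) (hBn : ∑ t, B t = n) :
    ∑ f ∈ contentFuns n A, ∑ g ∈ contentFuns n B,
        (((fiberPerms f ×ˢ fiberPerms g).filter fun q =>
          permType (q.1 * q.2) = Nat.Partition.indiscrete n).card : ℂ) =
      n.descFactorial (Fintype.card σ + Fintype.card τ - 1) *
        ((n - Fintype.card σ)! * (n - Fintype.card τ)!) := by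
  obtain ⟨s₀⟩ : Nonempty σ := by
    by_contra h
    rw [not_nonempty_iff] at h
    simp at hAn
    omega
  obtain ⟨t₀⟩ : Nonempty τ := by
    by_contra h
    rw [not_nonempty_iff] at h
    simp at hBn
    omega
  have hn0 : (n : ℂ) ^ 2 ≠ 0 := pow_ne_zero _ (Nat.cast_ne_zero.2 (by omega))
  rw [← sum_contentFuns_treeSum n s₀ t₀ A B hA hB hAn hBn, Finset.sum_mul]
  refine Finset.sum_congr rfl fun f hf => ?_
  rw [Finset.sum_mul]
  refine Finset.sum_congr rfl fun g hg => ?_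
  rw [mem_contentFuns] at hf hg
  refine mul_right_cancel₀ hn0 ?_
  have h1 := det_one_sub_permMat_mul_add_allOnes_sum f g
  simp only [det_one_sub_permMat_add_allOnes hn] at h1
  rw [← Finset.sum_product', ← Finset.sum_filter, Finset.sum_const, nsmul_eq_mul,
    card_fiberPerms, card_fiberPerms, hf, hg] at h1
  rw [h1]
  have h2 := treeSum_mul_card_sq (K := ℂ) s₀ (f := f) (g := g) (by simpa [hf] using hA)
    (by simpa [hg] using hB)
  rw [hf, hg, Fintype.card_fin] at h2
  rw [cast_prod_factorial A hA, cast_prod_factorial B hB]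
  linear_combination (-((∏ s, ((A s - 1)! : ℂ)) * ∏ t, ((B t - 1)! : ℂ))) * h2

end Core

end ColoredFactorizations

/-! ### Power sums as sums over colourings -/

section PowerSums

open Matrix

/-- `cycleType` omits fixed points, so orbits with at least two elements are matched with the cycle
factors, and singleton orbits with the parts equal to 1. -/
theorem permType_parts_eq_map_fiberCard {n : ℕ} (g : Equiv.Perm (Fin n))
    [Fintype (Quotient (Equiv.Perm.SameCycle.setoid g))]
    [DecidableEq (Quotient (Equiv.Perm.SameCycle.setoid g))] :
    (permType g).parts = (Finset.univ : Finset (Quotient (Equiv.Perm.SameCycle.setoid g))).val.map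
      (fiberCard (Quotient.mk (Equiv.Perm.SameCycle.setoid g))) := by
  classical
  set mk := Quotient.mk (Equiv.Perm.SameCycle.setoid g) with hmk
  have hmk_eq : ∀ x y, mk x = mk y ↔ g.SameCycle x y := fun x y => Quotient.eq
  have hsupp : ∀ x ∈ g.support, (g.cycleOf x).support.card = fiberCard mk (mk x) := by
    intro x hx
    rw [fiberCard]
    congr 1
    ext y
    rw [Equiv.Perm.mem_support_cycleOf_iff, Finset.mem_filter, eq_comm, hmk_eq]
    simp [hx]
  have hne : ∀ x, fiberCard mk (mk x) ≠ 1 ↔ x ∈ g.support := by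
    intro x
    constructor
    · intro h
      by_contra hx
      rw [Equiv.Perm.notMem_support] at hx
      refine h ?_
      rw [fiberCard, Finset.card_eq_one]
      refine ⟨x, ?_⟩
      ext y
      rw [Finset.mem_filter, eq_comm, hmk_eq, Finset.mem_singleton]
      simp only [Finset.mem_univ, true_and]
      exact ⟨fun h => (h.eq_of_left hx).symm, fun h => h ▸ Equiv.Perm.SameCycle.refl g x⟩
    · intro hx
      rw [← hsupp x hx]
      have := (Equiv.Perm.isCycle_cycleOf g (Equiv.Perm.mem_support.1 hx)).two_le_card_support
      omega
  let cyc : Quotient (Equiv.Perm.SameCycle.setoid g) → Equiv.Perm (Fin n) :=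
    Quotient.lift (fun x => g.cycleOf x) fun x y h => Equiv.Perm.SameCycle.cycleOf_eq h
  have hcyc : ∀ x, cyc (mk x) = g.cycleOf x := fun x => rfl
  have hsurj : ∀ q, ∃ x, mk x = q := Quotient.exists_rep
  have himg : g.cycleFactorsFinset =
      (Finset.univ.filter fun q => fiberCard mk q ≠ 1).image cyc := by
    ext c
    rw [Finset.mem_image]
    constructor
    · intro hc
      obtain ⟨x, hx⟩ := (Equiv.Perm.mem_cycleFactorsFinset_iff.1 hc).1.nonempty_support
      have hcx := Equiv.Perm.cycle_is_cycleOf hx hc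
      refine ⟨mk x, ?_, ?_⟩
      · rw [Finset.mem_filter, hne]
        exact ⟨Finset.mem_univ _, Equiv.Perm.mem_cycleFactorsFinset_support_le hc hx⟩
      · rw [hcyc, hcx]
    · rintro ⟨q, hq, rfl⟩
      obtain ⟨x, rfl⟩ := hsurj q
      rw [Finset.mem_filter, hne] at hq
      rw [hcyc, Equiv.Perm.cycleOf_mem_cycleFactorsFinset_iff]
      exact hq.2
  have hinj : Set.InjOn cyc (Finset.univ.filter fun q => fiberCard mk q ≠ 1 :
      Finset (Quotient (Equiv.Perm.SameCycle.setoid g))) := by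
    intro p hp q hq hpq
    obtain ⟨x, rfl⟩ := hsurj p
    obtain ⟨y, rfl⟩ := hsurj q
    rw [Finset.mem_coe, Finset.mem_filter, hne] at hp hq
    rw [hcyc, hcyc] at hpq
    rw [hmk_eq]
    have : y ∈ (g.cycleOf x).support := by
      rw [hpq, Equiv.Perm.mem_support_cycleOf_iff]
      exact ⟨Equiv.Perm.SameCycle.refl g y, hq.2⟩
    exact (Equiv.Perm.mem_support_cycleOf_iff.1 this).1
  have hct : g.cycleType =
      (Finset.univ.filter fun q => fiberCard mk q ≠ 1).val.map (fiberCard mk) := by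
    rw [Equiv.Perm.cycleType_def, himg, Finset.image_val_of_injOn hinj, Multiset.map_map]
    refine Multiset.map_congr rfl fun q hq => ?_
    obtain ⟨x, rfl⟩ := hsurj q
    have hq := (Finset.mem_filter.1 hq).2
    exact hsupp x ((hne x).1 hq)
  have hones : (Finset.univ.filter fun q => ¬ fiberCard mk q ≠ 1).val.map (fiberCard mk) =
      Multiset.replicate (Finset.univ.filter fun q => ¬ fiberCard mk q ≠ 1).card 1 := by
    rw [Multiset.eq_replicate]
    refine ⟨by rw [Multiset.card_map]; rfl, fun b hb => ?_⟩
    obtain ⟨q, hq, rfl⟩ := Multiset.mem_map.1 hb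
    exact not_not.1 (Finset.mem_filter.1 hq).2
  have hsplit : (Finset.univ : Finset (Quotient (Equiv.Perm.SameCycle.setoid g))).val.map
      (fiberCard mk) = g.cycleType +
        Multiset.replicate (Finset.univ.filter fun q => ¬ fiberCard mk q ≠ 1).card 1 := by
    rw [hct, ← hones, ← Multiset.map_add]
    congr 1
    exact (Multiset.filter_add_not _ _).symm
  have hsum : ((Finset.univ : Finset (Quotient (Equiv.Perm.SameCycle.setoid g))).val.map
      (fiberCard mk)).sum = n := by
    have := sum_fiberCard mk
    rwa [Fintype.card_fin] at this
  change g.partition.parts = _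
  rw [hsplit] at hsum ⊢
  rw [Multiset.sum_add, Multiset.sum_replicate, Equiv.Perm.sum_cycleType] at hsum
  rw [Equiv.Perm.parts_partition, Fintype.card_fin]
  congr 2
  simp only [smul_eq_mul, mul_one] at hsum
  omega

namespace MvPolynomial

variable {σ R : Type*} [CommSemiring R] [Fintype σ]

/-- Expanding the product of power sums chooses one colour for each cycle of `g`; such choices are
the colourings invariant under `g`. -/
theorem psumPart_permType [DecidableEq σ] {n : ℕ} (g : Equiv.Perm (Fin n)) :
    psumPart σ R (permType g) =
      ∑ f : Fin n → σ, if g ∈ fiberPerms f then ∏ i, X (f i) else 0 := by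
  classical
  let Q := Quotient (Equiv.Perm.SameCycle.setoid g)
  let mk : Fin n → Q := Quotient.mk (Equiv.Perm.SameCycle.setoid g)
  have h1 : psumPart σ R (permType g) = ∏ q : Q, ∑ s, (X s : MvPolynomial σ R) ^ fiberCard mk q := by
    rw [psumPart, permType_parts_eq_map_fiberCard, Multiset.map_map]
    rfl
  rw [h1, Finset.prod_univ_sum, Fintype.piFinset_univ, ← Finset.sum_filter]
  refine Finset.sum_nbij (fun h => h ∘ mk) ?_ ?_ ?_ ?_
  · intro h _
    rw [Finset.mem_filter, mem_fiberPerms]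
    refine ⟨Finset.mem_univ _, fun i => congrArg h (Quotient.sound ?_)⟩
    exact (Equiv.Perm.SameCycle.refl g i).apply_left
  · intro h _ h' _ e
    funext q
    obtain ⟨x, rfl⟩ := Quotient.exists_rep q
    exact congrFun e x
  · intro f hf
    rw [Finset.mem_coe, Finset.mem_filter, mem_fiberPerms] at hf
    have hz : ∀ (k : ℤ) x, f ((g ^ k) x) = f x := by
      intro k x
      induction k with
      | zero => rfl
      | succ k ih => rw [add_comm, _root_.zpow_add, zpow_one, Equiv.Perm.mul_apply, hf.2, ih]
      | pred k ih =>
        rw [← ih, ← hf.2 ((g ^ (-(k : ℤ) - 1)) x), ← Equiv.Perm.mul_apply, ← _root_.zpow_one_add]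
        congr 3
        ring
    refine ⟨Quotient.lift f ?_, Finset.mem_coe.2 (Finset.mem_univ _), rfl⟩
    rintro x y ⟨k, rfl⟩
    exact (hz k x).symm
  · intro h _
    rw [← Finset.prod_fiberwise Finset.univ mk]
    refine Finset.prod_congr rfl fun q _ => ?_
    rw [fiberCard, ← Finset.prod_const]
    refine Finset.prod_congr rfl fun i hi => ?_
    rw [Function.comp_apply, (Finset.mem_filter.1 hi).2]

theorem coeff_psumPart_permType [DecidableEq σ] {n : ℕ} (g : Equiv.Perm (Fin n)) (A : σ →₀ ℕ) :
    (psumPart σ R (permType g)).coeff A =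
      ((contentFuns n A).filter fun f => g ∈ fiberPerms f).card := by
  rw [psumPart_permType, coeff_sum, Finset.card_filter, contentFuns, Finset.sum_filter]
  push_cast
  refine Finset.sum_congr rfl fun f _ => ?_
  by_cases h : g ∈ fiberPerms f
  · simp [h, coeff_prod_X]
  · simp [h]

end MvPolynomial

/-- The one-colour case of the count: all pairs are admissible, so `n!` times the class size is `n
(n - 1)! (n - 1)!`. -/
theorem card_conjClass_indiscrete {n : ℕ} (hn : 1 ≤ n) :
    (conjClass (Nat.Partition.indiscrete n)).card = (n - 1)! := by
  have h := sum_contentFuns_card_longCycle_of_pos hn (fun _ : Unit => n) (fun _ : Unit => n)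
    (by intro; omega) (by intro; omega) (by simp) (by simp)
  have h1 : contentFuns n (fun _ : Unit => n) = {fun _ => ()} := by
    ext f
    rw [mem_contentFuns, Finset.mem_singleton]
    have : f = fun _ => () := rfl
    simp only [this, iff_true]
    funext s
    simp [fiberCard]
  have h2 : fiberPerms (fun _ : Fin n => ()) = Finset.univ := by
    ext g
    simp [mem_fiberPerms]
  rw [h1, Finset.sum_singleton, Finset.sum_singleton, h2] at h
  have h3 : (((Finset.univ : Finset (Equiv.Perm (Fin n))) ×ˢ
      (Finset.univ : Finset (Equiv.Perm (Fin n)))).filter fun q =>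
        permType (q.1 * q.2) = Nat.Partition.indiscrete n).card =
      n ! * (conjClass (Nat.Partition.indiscrete n)).card := by
    have h4 : n ! = (Finset.univ : Finset (Equiv.Perm (Fin n))).card := by
      rw [Finset.card_univ, Fintype.card_perm, Fintype.card_fin]
    rw [h4, ← Finset.card_product]
    refine Finset.card_nbij' (fun q => (q.1, q.1 * q.2)) (fun q => (q.1, q.1⁻¹ * q.2)) ?_ ?_ ?_ ?_
    · intro q hq
      simpa [mem_conjClass] using hq
    · intro q hq
      simpa [mem_conjClass] using hq
    · intro q _
      simp
    · intro q _
      simp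
  rw [h3] at h
  have h5 : n.descFactorial (Fintype.card Unit + Fintype.card Unit - 1) = n := by simp
  rw [h5] at h
  simp only [Fintype.card_unit] at h
  have h6 : n ! = n * (n - 1)! := (Nat.mul_factorial_pred (by omega)).symm
  have h7 : n ! * (conjClass (Nat.Partition.indiscrete n)).card = n ! * (n - 1)! := by
    conv_rhs => rw [h6]
    rw [mul_assoc]
    exact_mod_cast h
  exact Nat.eq_of_mul_eq_mul_left n.factorial_pos h7

end PowerSums

/-! ### The two-variable identity -/

section TwoVariables

open Matrix

section Supports

variable {σ τ : Type*} [Fintype σ] [DecidableEq σ] [Fintype τ] [DecidableEq τ]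

/-- Colourings with content `A` only use colours in the support of `A`. -/
theorem card_filter_contentFuns_support {n : ℕ} (g : Equiv.Perm (Fin n)) (A : σ →₀ ℕ) :
    ((contentFuns n A).filter fun f => g ∈ fiberPerms f).card =
      ((contentFuns n fun s : A.support => A s).filter fun f => g ∈ fiberPerms f).card := by
  have hval : ∀ (f : Fin n → A.support) (s : A.support),
      fiberCard (fun i => (f i : σ)) s = fiberCard f s := by
    intro f s
    simp only [fiberCard, Subtype.coe_inj]
  symm
  refine Finset.card_nbij (fun f i => (f i : σ)) ?_ ?_ ?_
  · intro f hf
    rw [Finset.mem_coe, Finset.mem_filter, mem_contentFuns, mem_fiberPerms] at hf ⊢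
    refine ⟨?_, fun i => congrArg Subtype.val (hf.2 i)⟩
    funext s
    by_cases hs : s ∈ A.support
    · rw [hval f ⟨s, hs⟩, hf.1]
    · rw [Finsupp.notMem_support_iff.1 hs, fiberCard, Finset.card_eq_zero,
        Finset.filter_eq_empty_iff]
      rintro i - rfl
      exact hs (f i).2
  · intro f _ f' _ h
    funext i
    exact Subtype.ext (congrFun h i)
  · intro f hf
    rw [Finset.mem_coe, Finset.mem_filter, mem_contentFuns, mem_fiberPerms] at hf
    have hmem : ∀ i, f i ∈ A.support := by
      intro i
      rw [Finsupp.mem_support_iff, ← hf.1]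
      exact_mod_cast fiberCard_apply_ne_zero (K := ℂ) f i
    refine ⟨fun i => ⟨f i, hmem i⟩, ?_, rfl⟩
    rw [Finset.mem_coe, Finset.mem_filter, mem_contentFuns, mem_fiberPerms]
    refine ⟨?_, fun i => Subtype.ext (hf.2 i)⟩
    funext s
    rw [← hval, hf.1]

theorem card_filter_product_fiberPerms {ι : Type*} [Fintype ι] [DecidableEq ι] (f : ι → σ)
    (g : ι → τ) (P : Equiv.Perm ι × Equiv.Perm ι → Prop) [DecidablePred P] :
    (((fiberPerms f ×ˢ fiberPerms g).filter P).card : ℂ) =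
      ∑ q, if P q then (if q.1 ∈ fiberPerms f then 1 else 0) *
        (if q.2 ∈ fiberPerms g then 1 else 0) else 0 := by
  have h : (fiberPerms f ×ˢ fiberPerms g).filter P =
      Finset.univ.filter fun q => P q ∧ q.1 ∈ fiberPerms f ∧ q.2 ∈ fiberPerms g := by
    ext q
    simp [and_comm]
  rw [h, Finset.card_filter]
  push_cast
  refine Finset.sum_congr rfl fun q _ => ?_
  by_cases h1 : P q <;> by_cases h2 : q.1 ∈ fiberPerms f <;>
    by_cases h3 : q.2 ∈ fiberPerms g <;> simp [h1, h2, h3]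

theorem sum_support_coe (A : σ →₀ ℕ) : ∑ s : A.support, A s = ∑ s, A s := by
  rw [Finset.sum_coe_sort A.support (fun s => A s)]
  exact Finset.sum_subset (Finset.subset_univ _) fun s _ hs => Finsupp.notMem_support_iff.1 hs

/-- Discarding unused colours makes all contents positive; then the sums over colourings and over
permutations are exchanged. -/
theorem sum_longCycle_card_mul_card {n : ℕ} (hn : 1 ≤ n) (A : σ →₀ ℕ) (B : τ →₀ ℕ)
    (hA : ∑ s, A s = n) (hB : ∑ t, B t = n) :
    ∑ q : Equiv.Perm (Fin n) × Equiv.Perm (Fin n),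
      (if permType (q.1 * q.2) = Nat.Partition.indiscrete n then
        (((contentFuns n A).filter fun f => q.1 ∈ fiberPerms f).card : ℂ) *
          ((contentFuns n B).filter fun f => q.2 ∈ fiberPerms f).card else 0) =
      n.descFactorial (A.support.card + B.support.card - 1) *
        ((n - A.support.card)! * (n - B.support.card)!) := by
  have h := sum_contentFuns_card_longCycle_of_pos hn (fun s : A.support => A s)
    (fun t : B.support => B t) (fun s => Finsupp.mem_support_iff.1 s.2)
    (fun s => Finsupp.mem_support_iff.1 s.2) ((sum_support_coe A).trans hA)
    ((sum_support_coe B).trans hB)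
  rw [Fintype.card_coe, Fintype.card_coe] at h
  rw [← h]
  simp only [card_filter_product_fiberPerms]
  rw [Finset.sum_congr rfl fun f _ => Finset.sum_comm, Finset.sum_comm]
  refine Finset.sum_congr rfl fun q _ => ?_
  rw [card_filter_contentFuns_support _ A, card_filter_contentFuns_support _ B]
  split_ifs
  · rw [← Finset.sum_mul_sum, Finset.sum_boole, Finset.sum_boole]
  · simp

end Supports

/-- Each of the `(n - 1)!` long cycles has the same number of factorizations. -/
theorem factorial_mul_connCoeff_indiscrete {n : ℕ} (hn : 1 ≤ n) (lam mu : n.Partition) :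
    ((n - 1)! : ℂ) * connCoeff lam mu (Nat.Partition.indiscrete n) =
      (((conjClass lam ×ˢ conjClass mu).filter fun q =>
        permType (q.1 * q.2) = Nat.Partition.indiscrete n).card : ℂ) := by
  have h1 : ((conjClass lam ×ˢ conjClass mu).filter fun q =>
        permType (q.1 * q.2) = Nat.Partition.indiscrete n).card =
      ∑ g ∈ conjClass (Nat.Partition.indiscrete n),
        ((conjClass lam ×ˢ conjClass mu).filter fun q => q.1 * q.2 = g).card := by
    rw [Finset.card_eq_sum_card_fiberwise (f := fun q => q.1 * q.2)
      (t := conjClass (Nat.Partition.indiscrete n))]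
    · refine Finset.sum_congr rfl fun g hg => ?_
      congr 1
      ext q
      simp only [Finset.mem_filter]
      constructor
      · rintro ⟨⟨h1, _⟩, h3⟩
        exact ⟨h1, h3⟩
      · rintro ⟨h1, rfl⟩
        exact ⟨⟨h1, mem_conjClass.1 hg⟩, rfl⟩
    · intro q hq
      exact mem_conjClass.2 (Finset.mem_filter.1 hq).2
  rw [h1, Nat.cast_sum, Finset.sum_congr rfl fun g hg => (connCoeff_eq_card lam mu _ hg).symm,
    Finset.sum_const, card_conjClass_indiscrete hn, nsmul_eq_mul]

theorem factorial_mul_sum_connCoeff {n : ℕ} (hn : 1 ≤ n) (F G : n.Partition → ℂ) :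
    ((n - 1)! : ℂ) * ∑ lam, ∑ mu,
        connCoeff lam mu (Nat.Partition.indiscrete n) * (F lam * G mu) =
      ∑ q : Equiv.Perm (Fin n) × Equiv.Perm (Fin n),
        if permType (q.1 * q.2) = Nat.Partition.indiscrete n then
          F (permType q.1) * G (permType q.2) else 0 := by
  rw [← Finset.sum_fiberwise Finset.univ
    (fun q : Equiv.Perm (Fin n) × Equiv.Perm (Fin n) => (permType q.1, permType q.2)),
    Fintype.sum_prod_type, Finset.mul_sum]
  refine Finset.sum_congr rfl fun lam _ => ?_
  rw [Finset.mul_sum]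
  refine Finset.sum_congr rfl fun mu _ => ?_
  rw [← mul_assoc, factorial_mul_connCoeff_indiscrete hn, ← Finset.sum_filter,
    Finset.filter_filter, Finset.card_eq_sum_ones, Nat.cast_sum, Finset.sum_mul]
  refine Finset.sum_congr ?_ ?_
  · ext q
    simp [mem_conjClass]
  · intro q hq
    simp only [Finset.mem_filter, Prod.mk.injEq] at hq
    rw [hq.2.1.1, hq.2.1.2, Nat.cast_one, one_mul]

/-- The coefficient `mvCoeff` as a function of the numbers of parts. -/
noncomputable def lengthCoeff (n k l : ℕ) : ℂ :=
  if k + l ≤ n + 1 then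
    (((n - k)! : ℕ) : ℂ) * (((n - l)! : ℕ) : ℂ) / (((n + 1 - (k + l))! : ℕ) : ℂ)
  else 0

theorem mvCoeff_eq_lengthCoeff {n : ℕ} (lam mu : n.Partition) :
    mvCoeff lam mu = lengthCoeff n (partLength lam) (partLength mu) := rfl

/-- The convention of a zero coefficient for `k + l > n + 1` matches the vanishing of the falling
factorial; `1 ≤ k` makes `k + l - 1` a true subtraction. -/
theorem descFactorial_mul_eq_lengthCoeff {n k l : ℕ} (hk : 1 ≤ k) :
    (n.descFactorial (k + l - 1) : ℂ) * ((n - k)! * (n - l)!) = n ! * lengthCoeff n k l := by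
  rw [lengthCoeff]
  split_ifs with h
  · have h1 := Nat.factorial_mul_descFactorial (show k + l - 1 ≤ n by omega)
    have h2 : n + 1 - (k + l) = n - (k + l - 1) := by omega
    have h3 : (((n - (k + l - 1))! : ℕ) : ℂ) ≠ 0 := Nat.cast_ne_zero.2 (Nat.factorial_ne_zero _)
    rw [h2, ← h1]
    push_cast
    field_simp
  · rw [Nat.descFactorial_eq_zero_iff_lt.2 (by omega)]
    simp

namespace MvPolynomial

variable {σ : Type*} [Fintype σ] [DecidableEq σ]

/-- Linear combinations of monomial symmetric polynomials whose coefficients depend only on the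
number of parts. -/
theorem sum_smul_msymm (n : ℕ) (F : ℕ → ℂ) :
    ∑ lam : n.Partition, F (partLength lam) • msymm σ ℂ lam =
      ∑ B ∈ (Finset.univ : Finset σ).finsuppAntidiag n, monomial B (F B.support.card) := by
  have h1 : ∑ lam : n.Partition, F (partLength lam) • msymm σ ℂ lam =
      ∑ a : Sym σ n, monomial (Multiset.toFinsupp (a : Multiset σ))
        (F (Multiset.toFinsupp (a : Multiset σ)).support.card) := by
    rw [← Finset.sum_fiberwise Finset.univ (fun a : Sym σ n => Nat.Partition.ofSym a)]
    refine Finset.sum_congr rfl fun lam _ => ?_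
    rw [msymm, Finset.smul_sum]
    refine (Finset.sum_subtype (Finset.univ.filter
      fun a : Sym σ n => Nat.Partition.ofSym a = lam) (by simp)
      (fun a : Sym σ n => F (partLength lam) •
        ((a : Multiset σ).map (X : σ → MvPolynomial σ ℂ)).prod)).symm.trans ?_
    refine Finset.sum_congr rfl fun a ha => ?_
    have h2 : ((a : Multiset σ).map (X : σ → MvPolynomial σ ℂ)).prod =
        monomial (Multiset.toFinsupp (a : Multiset σ)) 1 := by
      rw [monomial_eq, C_1, one_mul, Finsupp.prod, Finset.prod_multiset_map_count]
      rfl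
    have h3 : partLength lam = (Multiset.toFinsupp (a : Multiset σ)).support.card := by
      rw [← (Finset.mem_filter.1 ha).2, partLength, Nat.Partition.ofSym, Multiset.card_map]
      rfl
    rw [h2, h3, smul_monomial, smul_eq_mul, mul_one]
  rw [h1]
  refine Finset.sum_nbij (fun a => Multiset.toFinsupp (a : Multiset σ)) ?_ ?_ ?_ ?_
  · intro a _
    rw [Finset.mem_finsuppAntidiag]
    refine ⟨?_, Finset.subset_univ _⟩
    change ∑ s, (a : Multiset σ).count s = n
    rw [Multiset.sum_count_eq_card fun _ _ => Finset.mem_univ _]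
    exact a.2
  · intro a _ b _ h
    exact Sym.coe_injective (Multiset.toFinsupp.injective h)
  · intro B hB
    rw [Finset.mem_coe, Finset.mem_finsuppAntidiag] at hB
    refine ⟨⟨Finsupp.toMultiset B, ?_⟩, Finset.mem_coe.2 (Finset.mem_univ _), ?_⟩
    · rw [Finsupp.card_toMultiset, Finsupp.sum_fintype _ _ (fun _ => rfl)]
      exact hB.1
    · simp
  · intro a _
    rfl

theorem coeff_sum_smul_msymm (n : ℕ) (F : ℕ → ℂ) (A : σ →₀ ℕ) :
    ∑ lam : n.Partition, F (partLength lam) * (msymm σ ℂ lam).coeff A =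
      if ∑ s, A s = n then F A.support.card else 0 := by
  have h := congrArg (coeff A) (sum_smul_msymm (σ := σ) n F)
  simp only [coeff_sum, coeff_smul, smul_eq_mul, coeff_monomial, Finset.sum_ite_eq',
    Finset.mem_finsuppAntidiag, Finset.subset_univ, and_true] at h
  exact h

end MvPolynomial

theorem contentFuns_eq_empty {σ : Type*} [Fintype σ] [DecidableEq σ] {n : ℕ} {A : σ → ℕ}
    (hA : ∑ s, A s ≠ n) : contentFuns n A = ∅ := by
  rw [Finset.eq_empty_iff_forall_notMem]
  intro f hf
  rw [mem_contentFuns] at hf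
  refine hA ?_
  rw [← hf, sum_fiberCard, Fintype.card_fin]

open MvPolynomial in
-- Compare coefficients of `x^A y^B`. Both sides vanish unless `A` and `B` have sum `n`, and
-- otherwise depend only on the support sizes.
theorem sum_connCoeff_smul_psumPart_mul_psumPart (n : ℕ) (hn : 1 ≤ n) (σ τ : Type*) [Fintype σ]
    [DecidableEq σ] [Fintype τ] [DecidableEq τ] :
    (1 / (n : ℂ)) • ∑ lam : n.Partition, ∑ mu : n.Partition,
        connCoeff lam mu (Nat.Partition.indiscrete n) •
          (rename Sum.inl (psumPart σ ℂ lam) * rename Sum.inr (psumPart τ ℂ mu) :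
            MvPolynomial (σ ⊕ τ) ℂ) =
      ∑ lam : n.Partition, ∑ mu : n.Partition, mvCoeff lam mu •
        (rename Sum.inl (msymm σ ℂ lam) * rename Sum.inr (msymm τ ℂ mu) :
          MvPolynomial (σ ⊕ τ) ℂ) := by
  ext d
  obtain ⟨⟨A, B⟩, rfl⟩ := Finsupp.sumFinsuppEquivProdFinsupp.symm.surjective d
  change coeff (A.sumElim B) _ = coeff (A.sumElim B) _
  simp only [coeff_smul, coeff_sum, coeff_rename_inl_mul_rename_inr, smul_eq_mul]
  have hR : ∑ lam : n.Partition, ∑ mu : n.Partition,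
      mvCoeff lam mu * ((msymm σ ℂ lam).coeff A * (msymm τ ℂ mu).coeff B) =
      if ∑ s, A s = n then if ∑ t, B t = n then
        lengthCoeff n A.support.card B.support.card else 0 else 0 := by
    have h1 : ∀ lam : n.Partition, ∑ mu : n.Partition,
        mvCoeff lam mu * ((msymm σ ℂ lam).coeff A * (msymm τ ℂ mu).coeff B) =
        (if ∑ t, B t = n then lengthCoeff n (partLength lam) B.support.card else 0) *
          (msymm σ ℂ lam).coeff A := by
      intro lam
      rw [← coeff_sum_smul_msymm n (fun l => lengthCoeff n (partLength lam) l) B, Finset.sum_mul]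
      refine Finset.sum_congr rfl fun mu _ => ?_
      rw [mvCoeff_eq_lengthCoeff]
      ring
    simp only [h1]
    exact coeff_sum_smul_msymm n
      (fun k => if ∑ t, B t = n then lengthCoeff n k B.support.card else 0) A
  rw [hR]
  have hn0 : (n : ℂ) ≠ 0 := Nat.cast_ne_zero.2 (by omega)
  have hf0 : ((n - 1)! : ℂ) ≠ 0 := Nat.cast_ne_zero.2 (Nat.factorial_ne_zero _)
  have hL := factorial_mul_sum_connCoeff hn (fun lam => (psumPart σ ℂ lam).coeff A)
    (fun mu => (psumPart τ ℂ mu).coeff B)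
  simp only [coeff_psumPart_permType] at hL
  refine mul_left_cancel₀ hf0 ?_
  rw [mul_left_comm, hL]
  split_ifs with hA hB
  · rw [sum_longCycle_card_mul_card hn A B hA hB, descFactorial_mul_eq_lengthCoeff]
    · rw [← Nat.mul_factorial_pred (show n ≠ 0 by omega)]
      push_cast
      field_simp
    · rw [Nat.one_le_iff_ne_zero, Ne, Finset.card_eq_zero, Finsupp.support_eq_empty]
      rintro rfl
      simp at hA
      omega
  · simp [contentFuns_eq_empty hB]
  · simp [contentFuns_eq_empty hA]

end TwoVariables

/-! ### The identity for a long-cycle factor -/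

/-- Finitely supported functions with sum `n` and support `S` correspond to compositions. -/
theorem card_finsuppAntidiag_filter_support_eq {κ : Type*} [Fintype κ] [DecidableEq κ] {n : ℕ}
    (S : Finset κ) (hS : S.card ≤ n) :
    (((Finset.univ : Finset κ).finsuppAntidiag n).filter fun B => B.support = S).card =
      S.card.multichoose (n - S.card) := by
  rw [← Finset.card_finsuppAntidiag_nat_eq_multichoose]
  set I : κ →₀ ℕ := Finsupp.indicator S fun _ _ => 1 with hI
  have hind : ∀ s, I s = if s ∈ S then 1 else 0 := by
    intro s
    simp [hI, Finsupp.indicator_apply]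
  have hsum : ∑ s, I s = S.card := by
    simp [hind]
  -- Lower each entry on `S` by one, turning positive entries into arbitrary ones.
  refine Finset.card_nbij' (fun B => B - I)
    (fun B => B + I) ?_ ?_ ?_ ?_
  · intro B hB
    rw [Finset.mem_coe, Finset.mem_filter, Finset.mem_finsuppAntidiag] at hB
    obtain ⟨⟨h1, _⟩, h2⟩ := hB
    rw [Finset.mem_coe, Finset.mem_finsuppAntidiag]
    have h3 : (B - I).support ⊆ S := by
      intro s hs
      rw [← h2]
      exact Finsupp.support_tsub hs
    refine ⟨?_, h3⟩
    rw [Finset.sum_subset (Finset.subset_univ S)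
      fun s _ hs => Finsupp.notMem_support_iff.1 fun h => hs (h3 h)]
    have h4 : ∑ s, (B - I) s + S.card = n := by
      rw [← hsum, ← Finset.sum_add_distrib, ← h1]
      refine Finset.sum_congr rfl fun s _ => ?_
      rw [Finsupp.tsub_apply, hind]
      split_ifs with hs
      · rw [← h2, Finsupp.mem_support_iff] at hs
        omega
      · rfl
    omega
  · intro B hB
    rw [Finset.mem_coe, Finset.mem_finsuppAntidiag] at hB
    obtain ⟨h1, h2⟩ := hB
    rw [Finset.mem_coe, Finset.mem_filter, Finset.mem_finsuppAntidiag]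
    refine ⟨⟨?_, Finset.subset_univ _⟩, ?_⟩
    · change ∑ s, (B s + I s) = n
      rw [Finset.sum_add_distrib, hsum, ← Finset.sum_subset (Finset.subset_univ S)
        fun s _ hs => Finsupp.notMem_support_iff.1 fun h => hs (h2 h), h1]
      omega
    · ext s
      rw [Finsupp.mem_support_iff, Finsupp.add_apply, hind]
      split_ifs with hs
      · simp [hs]
      · simp [hs, Finsupp.notMem_support_iff.1 fun h => hs (h2 h)]
  · intro B hB
    rw [Finset.mem_coe, Finset.mem_filter] at hB
    ext s
    rw [Finsupp.add_apply, Finsupp.tsub_apply, hind]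
    split_ifs with hs
    · rw [← hB.2, Finsupp.mem_support_iff] at hs
      omega
    · rfl
  · intro B _
    simp

theorem card_support_le_of_sum {κ : Type*} [Fintype κ] (B : κ →₀ ℕ) :
    B.support.card ≤ ∑ s, B s := by
  rw [Finset.card_eq_sum_ones, ← Finset.sum_subset (Finset.subset_univ B.support)
    fun s _ hs => Finsupp.notMem_support_iff.1 hs]
  exact Finset.sum_le_sum fun s hs => Nat.one_le_iff_ne_zero.2 (Finsupp.mem_support_iff.1 hs)

/-- Choose a support of size `k + 1`, then a composition of `n` into `k + 1` parts; empty support is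
impossible for `n ≥ 1`. -/
theorem sum_finsuppAntidiag_card_support {κ M : Type*} [Fintype κ] [DecidableEq κ] [Semiring M]
    {n : ℕ} (hn : 1 ≤ n) (F : ℕ → M) :
    ∑ B ∈ (Finset.univ : Finset κ).finsuppAntidiag n, F B.support.card =
      ∑ k ∈ Finset.range n,
        (((Fintype.card κ).choose (k + 1) * (n - 1).choose k : ℕ) : M) * F (k + 1) := by
  have h1 : ∀ S : Finset κ, S.card ≤ n →
      ∑ B ∈ ((Finset.univ : Finset κ).finsuppAntidiag n).filter (fun B => B.support = S),
        F B.support.card = (S.card.multichoose (n - S.card) : M) * F S.card := by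
    intro S hS
    rw [← card_finsuppAntidiag_filter_support_eq S hS, Finset.card_eq_sum_ones, Nat.cast_sum,
      Finset.sum_mul]
    refine Finset.sum_congr rfl fun B hB => ?_
    rw [(Finset.mem_filter.1 hB).2, Nat.cast_one, one_mul]
  have h2 : ∀ k ∈ Finset.range (n + 1),
      ∑ B ∈ ((Finset.univ : Finset κ).finsuppAntidiag n).filter (fun B => B.support.card = k),
        F B.support.card =
      (((Fintype.card κ).choose k * k.multichoose (n - k) : ℕ) : M) * F k := by
    intro k hk
    rw [← Finset.sum_fiberwise_of_maps_to (t := Finset.powersetCard k Finset.univ)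
      (g := fun B : κ →₀ ℕ => B.support)]
    · rw [← Finset.card_univ (α := κ), ← Finset.card_powersetCard, Nat.cast_mul, mul_assoc,
        ← nsmul_eq_mul, ← Finset.sum_const]
      refine Finset.sum_congr rfl fun S hS => ?_
      have hSk := (Finset.mem_powersetCard.1 hS).2
      have := h1 S (by rw [hSk]; rw [Finset.mem_range] at hk; omega)
      rw [hSk] at this
      rw [← this, Finset.filter_filter]
      refine Finset.sum_congr ?_ fun _ _ => rfl
      ext B
      simp only [Finset.mem_filter]
      constructor
      · rintro ⟨h1, _, h3⟩
        exact ⟨h1, h3⟩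
      · rintro ⟨h1, rfl⟩
        exact ⟨h1, hSk, rfl⟩
    · intro B hB
      rw [Finset.mem_powersetCard]
      exact ⟨Finset.subset_univ _, (Finset.mem_filter.1 hB).2⟩
  rw [← Finset.sum_fiberwise_of_maps_to (t := Finset.range (n + 1))
    (g := fun B : κ →₀ ℕ => B.support.card), Finset.sum_congr rfl h2, Finset.sum_range_succ']
  · rw [show n - 0 = n - 1 + 1 by omega, Nat.multichoose_zero_succ, mul_zero, Nat.cast_zero, zero_mul,
      add_zero]
    refine Finset.sum_congr rfl fun k hk => ?_
    rw [Finset.mem_range] at hk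
    rw [Nat.multichoose_eq, Nat.choose_symm_of_eq_add (n := k + 1 + (n - (k + 1)) - 1)
      (a := n - (k + 1)) (b := k) (by omega)]
    congr 4
    omega
  · intro B hB
    rw [Finset.mem_finsuppAntidiag] at hB
    have := card_support_le_of_sum B
    rw [hB.1] at this
    rw [Finset.mem_range]
    omega

theorem alternating_sum_choose_succ {N n : ℕ} (hN : 1 ≤ N) (hn : N ≤ n) :
    ∑ k ∈ Finset.range n, (-1 : ℂ) ^ k * N.choose (k + 1) = 1 := by
  have h := Int.alternating_sum_range_choose (n := N)
  rw [if_neg (by omega), Finset.sum_range_succ'] at h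
  have h1 : ∑ k ∈ Finset.range n, (-1 : ℤ) ^ k * N.choose (k + 1) =
      ∑ k ∈ Finset.range N, (-1 : ℤ) ^ k * N.choose (k + 1) := by
    symm
    refine Finset.sum_subset (Finset.range_subset_range.2 hn) fun k _ hk => ?_
    rw [Finset.mem_range] at hk
    rw [Nat.choose_eq_zero_of_lt (by omega)]
    simp
  have h2 : ∑ k ∈ Finset.range n, (-1 : ℤ) ^ k * N.choose (k + 1) = 1 := by
    rw [h1]
    simp only [pow_succ, pow_zero, Nat.choose_zero_right, Nat.cast_one, mul_one, mul_neg,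
      neg_mul, Finset.sum_neg_distrib] at h
    linarith
  exact_mod_cast congrArg (Int.cast : ℤ → ℂ) h2

/-- With `N = n + 1 - l`, each summand equals `(n - 1)! / N` times `(-1)^k` times `N.choose (k +
1)`, and the alternating sum of these binomials is 1. -/
theorem sum_lengthCoeff_mul {n l : ℕ} (hl : 1 ≤ l) (hln : l ≤ n) :
    ∑ k ∈ Finset.range n, (-1 : ℂ) ^ k * (k ! : ℂ) / ((k + 1)! : ℂ) * (n - 1).choose k *
      lengthCoeff n l (k + 1) = (n - 1)! / ((n : ℂ) + 1 - l) := by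
  have hN : ((n + 1 - l : ℕ) : ℂ) = (n : ℂ) + 1 - l := by
    rw [Nat.cast_sub (by omega)]
    push_cast
    ring
  have hN0 : ((n + 1 - l : ℕ) : ℂ) ≠ 0 := Nat.cast_ne_zero.2 (by omega)
  have hf : ∀ m : ℕ, (m ! : ℂ) ≠ 0 := fun m => Nat.cast_ne_zero.2 (Nat.factorial_ne_zero m)
  have halt : ((n - 1)! : ℂ) / ((n : ℂ) + 1 - l) = ((n - 1)! : ℂ) / ((n + 1 - l : ℕ) : ℂ) *
      ∑ k ∈ Finset.range n, (-1 : ℂ) ^ k * (n + 1 - l).choose (k + 1) := by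
    rw [alternating_sum_choose_succ (by omega) (by omega), mul_one, hN]
  rw [halt, Finset.mul_sum]
  refine Finset.sum_congr rfl fun k hk => ?_
  rw [Finset.mem_range] at hk
  rw [lengthCoeff]
  split_ifs with h
  · obtain ⟨r, hr⟩ : ∃ r, n + 1 - l = k + 1 + r := ⟨n + 1 - l - (k + 1), by omega⟩
    have e1 : n + 1 - (l + (k + 1)) = r := by omega
    have e2 : n - l = k + r := by omega
    have h1 : (((n - 1).choose k : ℕ) : ℂ) * k ! * (n - (k + 1))! = (n - 1)! := by
      have := Nat.choose_mul_factorial_mul_factorial (show k ≤ n - 1 by omega)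
      rw [show n - 1 - k = n - (k + 1) by omega] at this
      exact_mod_cast this
    have h2 : (((k + 1 + r).choose (k + 1) : ℕ) : ℂ) * (k + 1)! * r ! = (k + 1 + r) * (k + r)! := by
      have := Nat.choose_mul_factorial_mul_factorial (show k + 1 ≤ k + 1 + r by omega)
      rw [show k + 1 + r - (k + 1) = r by omega, show k + 1 + r = (k + r) + 1 by ring,
        Nat.factorial_succ (k + r)] at this
      rw [show k + 1 + r = (k + r) + 1 by ring]
      have h3 := congrArg (Nat.cast : ℕ → ℂ) this
      push_cast at h3
      rw [h3]
      ring
    rw [hr] at hN0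
    rw [e1, e2, hr, ← h1]
    have h3 : ((k + r)! : ℂ) = ((k + 1 + r).choose (k + 1) : ℕ) * (k + 1)! * r ! /
        ((k + 1 + r : ℕ) : ℂ) := by
      rw [h2]
      push_cast at hN0 ⊢
      field_simp
    rw [h3]
    have := hf (k + 1)
    have := hf r
    field_simp
  · rw [Nat.choose_eq_zero_of_lt (show n + 1 - l < k + 1 by omega)]
    simp

theorem coeff_one_descPochhammer_succ (R : Type*) [CommRing R] (k : ℕ) :
    (descPochhammer R (k + 1)).coeff 1 = (-1) ^ k * (k ! : R) := by
  rw [descPochhammer_succ_left, Polynomial.coeff_X_mul, Polynomial.coeff_zero_eq_eval_zero,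
    Polynomial.eval_comp]
  simp only [Polynomial.eval_sub, Polynomial.eval_X, Polynomial.eval_one, zero_sub]
  induction k with
  | zero => simp
  | succ k ih =>
    rw [descPochhammer_succ_right, Polynomial.eval_mul, ih, Nat.factorial_succ]
    simp
    ring

theorem partLength_eq_one_iff {n : ℕ} (hn : 1 ≤ n) (mu : n.Partition) :
    partLength mu = 1 ↔ mu = Nat.Partition.indiscrete n := by
  rw [partLength, Multiset.card_eq_one, Nat.Partition.ext_iff,
    Nat.Partition.indiscrete_parts (by omega)]
  constructor
  · rintro ⟨a, ha⟩
    have := mu.parts_sum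
    rw [ha, Multiset.sum_singleton] at this
    rw [ha, this]
  · exact fun h => ⟨n, h⟩

theorem partLength_mem_Icc {n : ℕ} (hn : 1 ≤ n) (mu : n.Partition) :
    1 ≤ partLength mu ∧ partLength mu ≤ n := by
  constructor
  · rw [partLength, Nat.one_le_iff_ne_zero, Ne, Multiset.card_eq_zero]
    intro h
    have := mu.parts_sum
    rw [h, Multiset.sum_zero] at this
    omega
  · have h := Multiset.card_nsmul_le_sum (s := mu.parts) (a := 1)
      fun x hx => mu.parts_pos hx
    rw [mu.parts_sum] at h
    simpa [partLength] using h

open MvPolynomial in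
/-- The specialization `y = (1, …, 1)` of the two-variable identity. -/
theorem sum_connCoeff_smul_psumPart_pow (n : ℕ) (hn : 1 ≤ n) (σ : Type*) [Fintype σ]
    [DecidableEq σ] (t : ℕ) :
    ∑ mu : n.Partition, (∑ lam : n.Partition,
        connCoeff lam mu (Nat.Partition.indiscrete n) • psumPart σ ℂ lam) *
          (t : MvPolynomial σ ℂ) ^ partLength mu =
      ∑ k ∈ Finset.range n, (t.descFactorial (k + 1) : MvPolynomial σ ℂ) *
        ∑ lam : n.Partition, ((n : ℂ) / ((k + 1)! : ℂ) * (n - 1).choose k *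
          lengthCoeff n (partLength lam) (k + 1)) • msymm σ ℂ lam := by
  have hn0 : (n : ℂ) ≠ 0 := Nat.cast_ne_zero.2 (by omega)
  have h := congrArg (aeval (Sum.elim X fun _ => 1) :
    MvPolynomial (σ ⊕ Fin t) ℂ →ₐ[ℂ] MvPolynomial σ ℂ)
    (sum_connCoeff_smul_psumPart_mul_psumPart n hn σ (Fin t))
  have hl : ∀ p : MvPolynomial σ ℂ, (aeval (Sum.elim X fun _ => 1) :
      MvPolynomial (σ ⊕ Fin t) ℂ →ₐ[ℂ] MvPolynomial σ ℂ) (rename Sum.inl p) = p := by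
    intro p
    rw [aeval_rename, Sum.elim_comp_inl, aeval_X_left_apply]
  have hr : ∀ p : MvPolynomial (Fin t) ℂ, (aeval (Sum.elim X fun _ => 1) :
      MvPolynomial (σ ⊕ Fin t) ℂ →ₐ[ℂ] MvPolynomial σ ℂ) (rename Sum.inr p) =
        C (eval (fun _ => 1) p) := by
    intro p
    rw [aeval_rename, Sum.elim_comp_inr]
    induction p using MvPolynomial.induction_on with
    | C a => simp
    | add p q hp hq => rw [map_add, hp, hq, map_add, map_add]
    | mul_X p i hp => rw [map_mul, hp, aeval_X, map_mul, eval_X, mul_one, mul_one]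
  have hp : ∀ mu : n.Partition, eval (fun _ => 1) (psumPart (Fin t) ℂ mu) =
      (t : ℂ) ^ partLength mu := by
    intro mu
    have h1 : (eval (fun _ => (1 : ℂ)) ∘ psum (Fin t) ℂ) = Function.const ℕ (t : ℂ) := by
      funext i
      simp [psum]
    rw [psumPart, map_multiset_prod, Multiset.map_map, partLength, h1, Multiset.map_const,
      Multiset.prod_replicate]
  -- At the all-ones point each monomial counts 1, so this is a count of exponent vectors in `t`
  -- variables by support size.
  have hm : ∀ F : ℕ → ℂ, ∑ mu : n.Partition,
      F (partLength mu) * eval (fun _ => 1) (msymm (Fin t) ℂ mu) =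
      ∑ k ∈ Finset.range n, ((t.choose (k + 1) * (n - 1).choose k : ℕ) : ℂ) * F (k + 1) := by
    intro F
    have h1 := congrArg (eval fun _ => 1) (sum_smul_msymm (σ := Fin t) n F)
    simp only [map_sum, smul_eval, eval_monomial, one_pow, Finsupp.prod, Finset.prod_const_one,
      mul_one] at h1
    rw [h1, sum_finsuppAntidiag_card_support hn, Fintype.card_fin]
  simp only [map_smul, map_sum, map_mul, hl, hr, hp] at h
  have h2 : ∑ mu : n.Partition, (∑ lam : n.Partition,
        connCoeff lam mu (Nat.Partition.indiscrete n) • psumPart σ ℂ lam) *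
          (t : MvPolynomial σ ℂ) ^ partLength mu =
      (n : ℂ) • ∑ lam : n.Partition, ∑ mu : n.Partition, mvCoeff lam mu •
        (msymm σ ℂ lam * C (eval (fun _ => 1) (msymm (Fin t) ℂ mu))) := by
    rw [← h, smul_smul, mul_one_div_cancel hn0, one_smul, Finset.sum_comm]
    refine Finset.sum_congr rfl fun mu _ => ?_
    rw [Finset.sum_mul]
    refine Finset.sum_congr rfl fun lam _ => ?_
    rw [smul_mul_assoc]
    simp
  rw [h2, Finset.smul_sum]
  simp only [Finset.mul_sum]
  rw [Finset.sum_comm]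
  refine Finset.sum_congr rfl fun lam _ => ?_
  have h3 : ∑ mu : n.Partition, mvCoeff lam mu •
      (msymm σ ℂ lam * C (eval (fun _ => 1) (msymm (Fin t) ℂ mu))) =
      (∑ mu : n.Partition, lengthCoeff n (partLength lam) (partLength mu) *
        eval (fun _ => 1) (msymm (Fin t) ℂ mu)) • msymm σ ℂ lam := by
    rw [Finset.sum_smul]
    refine Finset.sum_congr rfl fun mu _ => ?_
    rw [mvCoeff_eq_lengthCoeff, mul_comm (msymm σ ℂ lam), ← smul_eq_C_mul, smul_smul]
  rw [h3, hm, smul_smul, Finset.mul_sum, Finset.sum_smul]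
  refine Finset.sum_congr rfl fun k _ => ?_
  rw [← map_natCast (C : ℂ →+* MvPolynomial σ ℂ), ← smul_eq_C_mul, smul_smul,
    Nat.descFactorial_eq_factorial_mul_choose]
  congr 1
  have : ((k + 1)! : ℂ) ≠ 0 := Nat.cast_ne_zero.2 (Nat.factorial_ne_zero _)
  push_cast
  field_simp

open MvPolynomial in
-- The specialized identity holds at every natural `t`, hence as an identity of polynomials in `t`
-- over the ring of symmetric variables' polynomials, and its linear coefficients agree.
theorem sum_connCoeff_indiscrete_smul_psumPart (n : ℕ) (hn : 1 ≤ n) (σ : Type*) [Fintype σ]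
    [DecidableEq σ] :
    (1 / ((n ! : ℕ) : ℂ)) • ∑ lam : n.Partition,
        connCoeff lam (Nat.Partition.indiscrete n) (Nat.Partition.indiscrete n) •
          psumPart σ ℂ lam =
      ∑ lam : n.Partition,
        (1 / ((n : ℂ) + 1 - (partLength lam : ℂ))) • msymm σ ℂ lam := by
  set a : n.Partition → MvPolynomial σ ℂ := fun mu => ∑ lam : n.Partition,
    connCoeff lam mu (Nat.Partition.indiscrete n) • psumPart σ ℂ lam with ha
  set b : ℕ → MvPolynomial σ ℂ := fun k => ∑ lam : n.Partition,
    ((n : ℂ) / ((k + 1)! : ℂ) * (n - 1).choose k *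
      lengthCoeff n (partLength lam) (k + 1)) • msymm σ ℂ lam with hb
  have hpoly : (∑ mu : n.Partition, Polynomial.C (a mu) * Polynomial.X ^ partLength mu) =
      ∑ k ∈ Finset.range n, Polynomial.C (b k) * descPochhammer (MvPolynomial σ ℂ) (k + 1) := by
    refine Polynomial.eq_of_infinite_eval_eq _ _
      (Set.Infinite.mono ?_ (Set.infinite_range_of_injective
        (Nat.cast_injective (R := MvPolynomial σ ℂ))))
    rintro _ ⟨t, rfl⟩
    simp only [Set.mem_ofPred_eq, Polynomial.eval_finsetSum, Polynomial.eval_mul, Polynomial.eval_C,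
      Polynomial.eval_pow, Polynomial.eval_X, descPochhammer_eval_eq_descFactorial]
    rw [sum_connCoeff_smul_psumPart_pow n hn σ t]
    exact Finset.sum_congr rfl fun k _ => mul_comm _ _
  have h1 := congrArg (fun p => Polynomial.coeff p 1) hpoly
  simp only [Polynomial.finsetSum_coeff, Polynomial.coeff_C_mul, Polynomial.coeff_X_pow,
    coeff_one_descPochhammer_succ] at h1
  -- The only partition with one part is `(n)`, so the linear coefficient isolates it.
  have h2 : ∀ mu : n.Partition, (a mu * if 1 = partLength mu then 1 else 0) =
      if mu = Nat.Partition.indiscrete n then a mu else 0 := by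
    intro mu
    rw [mul_ite, mul_one, mul_zero]
    exact if_congr (by rw [eq_comm, partLength_eq_one_iff hn]) rfl rfl
  simp only [h2, Finset.sum_ite_eq', Finset.mem_univ, if_true] at h1
  change (1 / ((n ! : ℕ) : ℂ)) • a (Nat.Partition.indiscrete n) = _
  rw [h1, hb]
  simp only [Finset.sum_mul]
  rw [Finset.sum_comm, Finset.smul_sum]
  refine Finset.sum_congr rfl fun lam _ => ?_
  obtain ⟨hl, hln⟩ := partLength_mem_Icc hn lam
  have h3 := sum_lengthCoeff_mul hl hln
  have hn0 : (n : ℂ) ≠ 0 := Nat.cast_ne_zero.2 (by omega)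
  have hf : ((n - 1)! : ℂ) ≠ 0 := Nat.cast_ne_zero.2 (Nat.factorial_ne_zero _)
  have h4 : ∀ k ∈ Finset.range n, ((n : ℂ) / ((k + 1)! : ℂ) * (n - 1).choose k *
      lengthCoeff n (partLength lam) (k + 1)) • msymm σ ℂ lam *
        ((-1) ^ k * (k ! : MvPolynomial σ ℂ)) =
      (n * ((-1 : ℂ) ^ k * (k ! : ℂ) / ((k + 1)! : ℂ) * (n - 1).choose k *
        lengthCoeff n (partLength lam) (k + 1))) • msymm σ ℂ lam := by
    intro k _
    have h5 : ((-1) ^ k * (k ! : MvPolynomial σ ℂ)) = C ((-1) ^ k * (k ! : ℂ)) := by simp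
    rw [h5, mul_comm, ← smul_eq_C_mul, smul_smul]
    congr 1
    ring
  rw [Finset.sum_congr rfl h4, ← Finset.sum_smul, ← Finset.mul_sum, h3, smul_smul,
    ← Nat.mul_factorial_pred (show n ≠ 0 by omega)]
  congr 1
  push_cast
  field_simp

theorem mainTheorem4 (n : ℕ) (hn : 1 ≤ n)
    {σ τ : Type*} [Fintype σ] [DecidableEq σ] [Fintype τ] [DecidableEq τ] :
    ((1 / (n : ℂ)) •
        ∑ lam : n.Partition, ∑ mu : n.Partition,
          connCoeff lam mu (Nat.Partition.indiscrete n) •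
            (MvPolynomial.rename Sum.inl (MvPolynomial.psumPart σ ℂ lam) *
              MvPolynomial.rename Sum.inr (MvPolynomial.psumPart τ ℂ mu) :
                MvPolynomial (σ ⊕ τ) ℂ) =
      ∑ lam : n.Partition, ∑ mu : n.Partition,
        mvCoeff lam mu •
          (MvPolynomial.rename Sum.inl (MvPolynomial.msymm σ ℂ lam) *
            MvPolynomial.rename Sum.inr (MvPolynomial.msymm τ ℂ mu) :
              MvPolynomial (σ ⊕ τ) ℂ)) ∧
    ((1 / ((n ! : ℕ) : ℂ)) •
        ∑ lam : n.Partition,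
          connCoeff lam (Nat.Partition.indiscrete n) (Nat.Partition.indiscrete n) •
            MvPolynomial.psumPart σ ℂ lam =
      ∑ lam : n.Partition,
        (1 / ((n : ℂ) + 1 - (partLength lam : ℂ))) • MvPolynomial.msymm σ ℂ lam) :=
  ⟨sum_connCoeff_smul_psumPart_mul_psumPart n hn σ τ,
    sum_connCoeff_indiscrete_smul_psumPart n hn σ⟩
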